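/- Let $N\ge 2$ be even, let $S\subset\{1,\dots,N\}$ with $|S|=N/2$, and write $i\sim j$ if $i,j$ are both in $S$ or both in $S^c$, and $i\not\sim j$ otherwise. The block spin Ising model with parameters $\alpha,\beta$ and blocks $(S,S^c)$ is the probability measure on $\{-1,+1\}^N$ $$\mu_{N,\alpha,\beta,S}(\sigma)=\frac{e^{-H_{N,\alpha,\beta,S}(\sigma)}}{\sum_{\sigma'}e^{-H_{N,\alpha,\beta,S}(\sigma')}},\qquad H_{N,\alpha,\beta,S}(\sigma)=-\frac{\beta}{2N}\sum_{i\sim j}\sigma_i\sigma_j-\frac{\alpha}{2N}\sum_{i\not\sim j}\sigma_i\sigma_j ,$$ where the sums run over ordered pairs $(i,j)\in\{1,\dots,N\}^2$. **Theorem.** Let $\alpha,\beta\in\mathbb R$ satisfy $|\alpha|\le\beta$, $\alpha<\beta$, $\alpha\ne0$ and $|\alpha|+\beta=2$. * If $\alpha>0$, there are a constant $C_3>0$ and an algorithm (a computable function whose input is a finite list of configurations), depending only on $\alpha,\beta$, such that for every even $N\ge2$, every $S\subset\{1,\dots,N\}$ with $|S|=N/2$, every $\delta\in(0,1)$ and every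 $n\in\mathbb N$ with $$n\ge C_3\,N\log(N/\delta),$$ the algorithm, applied to $n$ independent observations $\sigma^{(1)},\dots,\sigma^{(n)}$ with law $\mu_{N,\alpha,\beta,S}$, recovers the block structure exactly, i.e. outputs $S$ or $S^c$, with probability at least $1-\delta$. * If $\alpha<0$, there are a constant $C_4>0$ and an algorithm, depending only on $\alpha,\beta$, such that the same conclusion holds for all such $N,S,\delta$ and all $n\in\mathbb N$ with $$n\ge C_4\,\sqrt N\,\log(N/\delta).$$ -/

import Mathlib

open MeasureTheory

noncomputable section

namespace BlockIsing

/-- A spin configuration on `N` sites; `true` codes the spin `+1` and `false` the spin `-1`. -/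
abbrev Config (N : ℕ) : Type := Fin N → Bool

/-- The numerical value `±1` of a spin. -/
def spin (b : Bool) : ℝ := if b then 1 else -1

/-- The sites `i` and `j` are in the same block of the partition `(S, Sᶜ)`. -/
def SameBlock {N : ℕ} (S : Finset (Fin N)) (i j : Fin N) : Prop := i ∈ S ↔ j ∈ S

instance {N : ℕ} (S : Finset (Fin N)) (i j : Fin N) : Decidable (SameBlock S i j) :=
  inferInstanceAs (Decidable (i ∈ S ↔ j ∈ S))

/-- The block spin Hamiltonian
`H(σ) = - β / (2N) ∑_{i ∼ j} σ_i σ_j - α / (2N) ∑_{i ≁ j} σ_i σ_j`;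
both sums run over ordered pairs, and the first one includes the pairs `i = j`. -/
def hamiltonian {N : ℕ} (α β : ℝ) (S : Finset (Fin N)) (σ : Config N) : ℝ :=
  -(β / (2 * (N : ℝ))) *
      (∑ i : Fin N, ∑ j : Fin N, if SameBlock S i j then spin (σ i) * spin (σ j) else 0)
    - (α / (2 * (N : ℝ))) *
      (∑ i : Fin N, ∑ j : Fin N, if SameBlock S i j then 0 else spin (σ i) * spin (σ j))

/-- The partition function. -/
def partitionFunction {N : ℕ} (α β : ℝ) (S : Finset (Fin N)) : ℝ :=
  ∑ σ : Config N, Real.exp (-hamiltonian α β S σ)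

/-- The Gibbs weight of a configuration. -/
def gibbsWeight {N : ℕ} (α β : ℝ) (S : Finset (Fin N)) (σ : Config N) : ℝ :=
  Real.exp (-hamiltonian α β S σ) / partitionFunction α β S

theorem partitionFunction_pos {N : ℕ} (α β : ℝ) (S : Finset (Fin N)) :
    0 < partitionFunction α β S :=
  Finset.sum_pos (fun _ _ => Real.exp_pos _) Finset.univ_nonempty

theorem gibbsWeight_nonneg {N : ℕ} (α β : ℝ) (S : Finset (Fin N)) (σ : Config N) :
    0 ≤ gibbsWeight α β S σ :=
  div_nonneg (Real.exp_pos _).le (partitionFunction_pos α β S).le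

theorem sum_gibbsWeight {N : ℕ} (α β : ℝ) (S : Finset (Fin N)) :
    ∑ σ : Config N, gibbsWeight α β S σ = 1 := by
  unfold gibbsWeight
  rw [← Finset.sum_div]
  exact div_self (partitionFunction_pos α β S).ne'

/-- The Gibbs measure of the block spin Ising model, as a probability mass function. -/
def gibbs {N : ℕ} (α β : ℝ) (S : Finset (Fin N)) : PMF (Config N) :=
  PMF.ofFintype (fun σ => ENNReal.ofReal (gibbsWeight α β S σ)) (by
    rw [← ENNReal.ofReal_sum_of_nonneg (fun σ _ => gibbsWeight_nonneg α β S σ),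
      sum_gibbsWeight, ENNReal.ofReal_one])

/-- The joint law of `n` independent observations `σ⁽¹⁾, …, σ⁽ⁿ⁾` drawn from the Gibbs measure. -/
def observationLaw {N : ℕ} (α β : ℝ) (S : Finset (Fin N)) (n : ℕ) :
    Measure (Fin n → Config N) :=
  Measure.pi fun _ : Fin n => (gibbs α β S).toMeasure

/-- The observations, written down as the list of their spin lists: the input of an algorithm. -/
def encodeObservations {N n : ℕ} (σ : Fin n → Config N) : List (List Bool) :=
  List.ofFn fun k => List.ofFn (σ k)

/-- The list of the `N` membership bits of a set of sites. -/
def encodeBlock {N : ℕ} (S : Finset (Fin N)) : List Bool :=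
  List.ofFn fun i => decide (i ∈ S)

/-- The output describes one of the blocks `S`, `Sᶜ`, that is, the partition `{S, Sᶜ}`. The
Gibbs measures of `S` and `Sᶜ` coincide, so which block is called `S` has no meaning. -/
def IsBlockStructure {N : ℕ} (S : Finset (Fin N)) (output : List Bool) : Prop :=
  output = encodeBlock S ∨ output = encodeBlock Sᶜ

/-- The probability that `A`, run on `n` independent observations from the model with blocks
`(S, Sᶜ)`, recovers the block structure exactly. -/
def recoveryProbability {N : ℕ} (α β : ℝ) (S : Finset (Fin N)) (n : ℕ)
    (A : List (List Bool) → List Bool) : ℝ :=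
  (observationLaw α β S n).real {σ | IsBlockStructure S (A (encodeObservations σ))}

end BlockIsing

end

/-!
The algorithm is the maximum likelihood estimator over balanced partitions, found by exhaustive
search. As `α < β`, it maximises the sum over the observations of `D_T ^ 2`, where `D_T` is the
difference of the magnetisations of `T` and its complement (`recoverBlock`). The same algorithm
serves both signs of `α`.

By the Hubbard–Stratonovich transformation the Gibbs measure is a mixture of product measures
(`gibbsWeight_eq_integral`): given two latent Gaussian-type fields `u` and `v`, the spins are
independent, with external field `u + v` on `S` and `u - v` on `Sᶜ`. Let `g` be half the difference
of the mean spins of the two blocks. For a competing partition `T` at distance `j ≤ N / 2` from `S`,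
`D_S ^ 2 - D_T ^ 2 = 4 U V`, where `V` and `U` are signed sums over the `j` sites where `S` and `T`
differ and over the remaining ones. Given the latent fields, `U` and `V` are independent and
sub-Gaussian with means `(N - j) g` and `j g`, so that
`E exp (-(s / N) U V) ≤ exp (-j (s g ^ 2 / 4 - s ^ 2 / N))` for `s ≤ 1 / 4`
(`sum_fieldWeight_mul_exp_blockDiff_le`).

The bound for a sample has the form `X ^ j`, with `X` a product over the observations. Summing it
over all `T` gives `(1 + X) ^ N - 1`, whose minimum with `1` is at most `2 N X`
(`sum_misrankedSamples_fieldWeight_le`). Truncating before the latent fields are integrated out is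
essential for `α < 0`: a single competitor at distance of order `N` beats `S` with a probability that
is not small enough for the union bound, the reason being atypically small latent fields that are
common to all competitors. Integrating `X` over the latent fields leaves
`2 N exp (-c n E g ^ 2)` (`observationLaw_misrankedSamples_le`).

It remains to bound `E g ^ 2` from below. On the critical line exactly one of the two latent fields
is critical. For `α > 0` this is `u`, and the subcritical `v` has order `N ^ (-1/2)`, hence so has
`g`. For `α < 0` it is `v`; its density is comparable to `exp (-c N v ^ 4)`, so `g` has order
`N ^ (-1/4)`. These are `exists_blockGap_lower_bound_of_magnetisation_critical` and
`exists_blockGap_lower_bound_of_difference_critical`.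
-/

open ProbabilityTheory

namespace BlockIsing

/-! ### Gaussian integrals and inequalities for hyperbolic functions -/

theorem integral_exp_mul_stdGaussian (t : ℝ) :
    ∫ x, Real.exp (t * x) ∂(gaussianReal 0 1) = Real.exp (t ^ 2 / 2) := by
  have h := congrFun (mgf_fun_id_gaussianReal (μ := 0) (v := 1)) t
  simpa [mgf] using h

theorem integral_stdGaussian (f : ℝ → ℝ) :
    ∫ x, f x ∂(gaussianReal 0 1) =
      (√(2 * Real.pi))⁻¹ * ∫ x, Real.exp (-(x ^ 2 / 2)) * f x := by
  rw [integral_gaussianReal_eq_integral_smul one_ne_zero, ← integral_const_mul]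
  refine integral_congr_ae (ae_of_all _ fun x => ?_)
  simp [gaussianPDFReal, mul_assoc, neg_div]

theorem integrable_stdGaussian_iff (f : ℝ → ℝ) :
    Integrable f (gaussianReal 0 1) ↔ Integrable fun x => Real.exp (-(x ^ 2 / 2)) * f x := by
  rw [gaussianReal_of_var_ne_zero 0 one_ne_zero,
    integrable_withDensity_iff_integrable_smul' (measurable_gaussianPDF 0 1)
      (ae_of_all _ fun _ => gaussianPDF_lt_top)]
  have h2 : (√(2 * Real.pi))⁻¹ ≠ 0 := by positivity
  rw [← integrable_const_mul_iff (isUnit_iff_ne_zero.mpr h2)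
    (fun x => Real.exp (-(x ^ 2 / 2)) * f x)]
  refine integrable_congr (ae_of_all _ fun x => ?_)
  simp [toReal_gaussianPDF, gaussianPDFReal, mul_assoc, neg_div]

/-- Completing the square in the exponent of a Gaussian integral. -/
theorem gaussian_weight_mul_exp_quadratic {q : ℝ} (p : ℝ) (hq : q < 1 / 2) (x : ℝ) :
    Real.exp (-(x ^ 2 / 2)) * Real.exp (p * x + q * x ^ 2) =
      Real.exp (p ^ 2 / (2 * (1 - 2 * q))) *
        Real.exp (-((1 - 2 * q) / 2) * (x - p / (1 - 2 * q)) ^ 2) := by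
  have h : (1 - 2 * q) ≠ 0 := by linarith
  rw [← Real.exp_add, ← Real.exp_add]
  congr 1
  field_simp
  ring

theorem integrable_exp_quadratic_stdGaussian {q : ℝ} (p : ℝ) (hq : q < 1 / 2) :
    Integrable (fun x => Real.exp (p * x + q * x ^ 2)) (gaussianReal 0 1) := by
  rw [integrable_stdGaussian_iff]
  simp_rw [gaussian_weight_mul_exp_quadratic p hq]
  exact ((integrable_exp_neg_mul_sq (by linarith)).comp_sub_right _).const_mul _

theorem integral_exp_quadratic_stdGaussian {q : ℝ} (p : ℝ) (hq : q < 1 / 2) :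
    ∫ x, Real.exp (p * x + q * x ^ 2) ∂(gaussianReal 0 1) =
      Real.exp (p ^ 2 / (2 * (1 - 2 * q))) * √(1 / (1 - 2 * q)) := by
  have h : 0 < 1 - 2 * q := by linarith
  rw [integral_stdGaussian]
  simp_rw [gaussian_weight_mul_exp_quadratic p hq]
  rw [integral_const_mul, integral_sub_right_eq_self
    (fun x => Real.exp (-((1 - 2 * q) / 2) * x ^ 2)), integral_gaussian, mul_left_comm]
  congr 1
  rw [← Real.sqrt_inv, ← Real.sqrt_mul (by positivity)]
  congr 1
  have := Real.pi_pos.ne'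
  field_simp

theorem integral_exp_quadratic_stdGaussian_le {q : ℝ} (p : ℝ) (h0 : 0 ≤ q) (hq : q ≤ 1 / 4) :
    ∫ x, Real.exp (p * x + q * x ^ 2) ∂(gaussianReal 0 1) ≤ Real.exp (p ^ 2 + 2 * q) := by
  rw [integral_exp_quadratic_stdGaussian p (by linarith), Real.exp_add]
  have h : 0 < 1 - 2 * q := by linarith
  gcongr
  · rw [div_le_iff₀ (by positivity)]
    nlinarith [sq_nonneg p]
  · refine Real.sqrt_le_iff.mpr ⟨by positivity, ?_⟩
    rw [← Real.exp_nat_mul, div_le_iff₀ h]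
    have := Real.add_one_le_exp ((2 : ℕ) * (2 * q))
    push_cast at this ⊢
    nlinarith

/-- Hoeffding's bound on the moment generating function of a spin with mean `tanh h`. -/
theorem cosh_add_le (h l : ℝ) :
    Real.cosh (h + l) ≤ Real.cosh h * Real.exp (l * Real.tanh h + l ^ 2 / 2) := by
  wlog hl : 0 ≤ l generalizing h l
  · have := this (-h) (-l) (by linarith)
    rw [Real.cosh_neg, Real.tanh_neg, ← neg_add, Real.cosh_neg] at this
    simpa using this
  have hlog : ∀ x, HasDerivAt (fun x => Real.log (Real.cosh x)) (Real.tanh x) x := fun x => by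
    simpa [Real.tanh_eq_sinh_div_cosh] using
      (Real.hasDerivAt_cosh x).log (Real.cosh_pos x).ne'
  have htanh : ∀ x, HasDerivAt (fun x => x - Real.tanh x) (1 - 1 / Real.cosh x ^ 2) x :=
    fun x => by
      have h1 := (Real.hasDerivAt_sinh x).div (Real.hasDerivAt_cosh x) (Real.cosh_pos x).ne'
      have h2 : (fun x => x - Real.tanh x) = fun x => x - (Real.sinh / Real.cosh) x := by
        ext x; simp [Real.tanh_eq_sinh_div_cosh]
      rw [h2]
      refine ((hasDerivAt_id x).sub h1).congr_deriv ?_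
      have := Real.cosh_sq x
      congr 2
      linarith
  have hmono : Monotone fun x => x - Real.tanh x :=
    monotone_of_deriv_nonneg (fun x => (htanh x).differentiableAt) fun x => by
      rw [(htanh x).deriv, sub_nonneg, div_le_one (by positivity)]
      exact one_le_pow₀ (Real.one_le_cosh x)
  have hF : ∀ x, HasDerivAt (fun x => x * Real.tanh h + x ^ 2 / 2 - Real.log (Real.cosh (h + x)))
      (Real.tanh h + x - Real.tanh (h + x)) x := fun x => by
    have h1 := (hlog (h + x)).comp x ((hasDerivAt_id x).const_add h)
    have h2 := ((hasDerivAt_id x).mul_const (Real.tanh h)).add ((hasDerivAt_pow 2 x).div_const 2)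
    refine (h2.sub h1).congr_deriv ?_
    simp
  have hmon : MonotoneOn
      (fun x => x * Real.tanh h + x ^ 2 / 2 - Real.log (Real.cosh (h + x))) (Set.Ici 0) := by
    refine monotoneOn_of_deriv_nonneg (convex_Ici 0)
      (fun x _ => (hF x).continuousAt.continuousWithinAt)
      (fun x _ => (hF x).differentiableAt.differentiableWithinAt) fun x hx => ?_
    rw [(hF x).deriv]
    have hx0 : 0 ≤ x := by simpa using interior_subset hx
    have := hmono (show h ≤ h + x by linarith)
    simp only at this
    linarith
  have h0 := hmon (Set.mem_Ici.mpr le_rfl) (Set.mem_Ici.mpr hl) hl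
  simp only [zero_mul, add_zero] at h0
  rw [← Real.log_le_log_iff (Real.cosh_pos _) (by positivity),
    Real.log_mul (Real.cosh_pos _).ne' (Real.exp_pos _).ne', Real.log_exp]
  linarith

theorem cosh_mul_one_add_le (v : ℝ) :
    Real.cosh v * (1 + v ^ 4 / 32) ≤ Real.exp (v ^ 2 / 2) := by
  have e2 : Real.exp (v ^ 2 / 2) = Real.exp (v ^ 2 / 4) ^ 2 := by
    rw [← Real.exp_nat_mul]; congr 1; push_cast; ring
  have c2 : Real.cosh v ≤ 2 * Real.exp (v ^ 2 / 4) - 1 := by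
    have h1 : Real.cosh v = 2 * Real.cosh (v / 2) ^ 2 - 1 := by
      have := Real.cosh_two_mul (v / 2)
      have h3 := Real.cosh_sq (v / 2)
      rw [show 2 * (v / 2) = v by ring] at this
      linarith
    have h2 := Real.cosh_le_exp_half_sq (v / 2)
    have h3 : Real.cosh (v / 2) ^ 2 ≤ Real.exp (v ^ 2 / 4) := by
      calc Real.cosh (v / 2) ^ 2 ≤ Real.exp ((v / 2) ^ 2 / 2) ^ 2 := by
            gcongr
        _ = Real.exp (v ^ 2 / 4) := by rw [← Real.exp_nat_mul]; congr 1; push_cast; ring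
    linarith
  set E := Real.exp (v ^ 2 / 4) with hE
  have hx : 0 ≤ v ^ 2 / 4 := by positivity
  -- `(E - 1)² ≥ x² E` for `E = exp x` and `x ≥ 0`, which is `2 sinh (x / 2) ≥ x`.
  have key : (v ^ 2 / 4) ^ 2 * E ≤ (E - 1) ^ 2 := by
    have hs : v ^ 2 / 8 ≤ Real.sinh (v ^ 2 / 8) := Real.self_le_sinh_iff.mpr (by positivity)
    have hF : E - 1 = 2 * Real.sinh (v ^ 2 / 8) * Real.exp (v ^ 2 / 8) := by
      rw [Real.sinh_eq, hE, show v ^ 2 / 4 = v ^ 2 / 8 + v ^ 2 / 8 by ring, Real.exp_add]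
      have : Real.exp (-(v ^ 2 / 8)) * Real.exp (v ^ 2 / 8) = 1 := by
        rw [← Real.exp_add]; simp
      linear_combination this
    have hE2 : E = Real.exp (v ^ 2 / 8) ^ 2 := by
      rw [hE, ← Real.exp_nat_mul]; congr 1; push_cast; ring
    rw [hF, mul_pow _ (Real.exp _), ← hE2]
    have : (v ^ 2 / 4) ^ 2 ≤ (2 * Real.sinh (v ^ 2 / 8)) ^ 2 := by
      gcongr; linarith
    gcongr
  have hE1 : 0 < E := Real.exp_pos _
  rw [e2]
  nlinarith [mul_le_mul_of_nonneg_right c2 (show 0 ≤ 1 + v ^ 4 / 32 by positivity),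
    show 0 ≤ v ^ 4 / 32 by positivity]

theorem one_add_sq_div_two_le_cosh (v : ℝ) : 1 + v ^ 2 / 2 ≤ Real.cosh v := by
  have h1 : Real.cosh v = 1 + 2 * Real.sinh (|v| / 2) ^ 2 := by
    have h2 := Real.cosh_two_mul (|v| / 2)
    have h3 := Real.cosh_sq (|v| / 2)
    rw [show 2 * (|v| / 2) = |v| by ring, Real.cosh_abs] at h2
    linarith
  have h4 : |v| / 2 ≤ Real.sinh (|v| / 2) := Real.self_le_sinh_iff.mpr (by positivity)
  have h5 : (|v| / 2) ^ 2 ≤ Real.sinh (|v| / 2) ^ 2 := by gcongr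
  rw [div_pow, sq_abs] at h5
  linarith

theorem one_sub_le_exp_mul_cosh (v : ℝ) :
    1 - v ^ 4 / 4 ≤ Real.exp (-(v ^ 2 / 2)) * Real.cosh v := by
  have h1 : 1 - v ^ 2 / 2 ≤ Real.exp (-(v ^ 2 / 2)) := by
    linarith [Real.add_one_le_exp (-(v ^ 2 / 2))]
  have h2 : 1 + v ^ 2 / 2 ≤ Real.cosh v := one_add_sq_div_two_le_cosh v
  nlinarith [Real.exp_pos (-(v ^ 2 / 2)), mul_le_mul_of_nonneg_right h1
    (show 0 ≤ 1 + v ^ 2 / 2 by positivity), mul_le_mul_of_nonneg_left h2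
    (Real.exp_pos (-(v ^ 2 / 2))).le]

theorem cosh_add_mul_cosh_sub (u v : ℝ) :
    Real.cosh (u + v) * Real.cosh (u - v) = Real.cosh u ^ 2 + Real.sinh v ^ 2 := by
  rw [Real.cosh_add, Real.cosh_sub]
  linear_combination (Real.cosh u ^ 2) * Real.cosh_sq v + Real.sinh v ^ 2 * Real.cosh_sq u

/-! ### The critical and the subcritical latent field -/

theorem integrable_exp_mul_abs_stdGaussian (c : ℝ) :
    Integrable (fun x => Real.exp (c * |x|)) (gaussianReal 0 1) :=
  integrable_exp_mul_abs (integrable_exp_mul_gaussianReal c) (integrable_exp_mul_gaussianReal (-c))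

theorem cosh_le_exp_abs (x : ℝ) : Real.cosh x ≤ Real.exp |x| := by
  rw [Real.cosh_eq]
  have h1 := Real.exp_le_exp.mpr (le_abs_self x)
  have h2 := Real.exp_le_exp.mpr (neg_le_abs x)
  linarith

theorem integrable_cosh_pow (p : ℝ) (N : ℕ) :
    Integrable (fun x => Real.cosh (p * x) ^ N) (gaussianReal 0 1) := by
  refine (integrable_exp_mul_abs_stdGaussian (N * |p|)).mono'
    (by fun_prop) (ae_of_all _ fun x => ?_)
  rw [Real.norm_of_nonneg (by positivity)]
  calc Real.cosh (p * x) ^ N ≤ Real.exp |p * x| ^ N := by gcongr; exact cosh_le_exp_abs _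
    _ = Real.exp (N * |p| * |x|) := by rw [← Real.exp_nat_mul, abs_mul, mul_assoc]

theorem stdGaussian_real_Icc_pos {a b : ℝ} (h : a < b) :
    0 < (gaussianReal 0 1).real (Set.Icc a b) := by
  rw [measureReal_def, ENNReal.toReal_pos_iff]
  refine ⟨?_, measure_lt_top _ _⟩
  rw [pos_iff_ne_zero]
  intro h0
  have := (gaussianReal_absolutelyContinuous' (0 : ℝ) (v := 1) one_ne_zero) h0
  simp at this
  linarith

/-- The latent field of a critical mode is at most of order `1` after normalisation by `√N`. -/
theorem exists_integral_cosh_pow_le_setIntegral_Icc :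
    ∃ C : ℝ, 0 < C ∧ ∀ N : ℕ, 0 < N →
      ∫ x, Real.cosh (1 / √N * x) ^ N ∂(gaussianReal 0 1) ≤
        C * ∫ x in Set.Icc (-(4 * √N)) (4 * √N), Real.cosh (1 / √N * x) ^ N
          ∂(gaussianReal 0 1) := by
  set K := ∫ x, Real.exp (0 * x + 1 / 4 * x ^ 2) ∂(gaussianReal 0 1) with hK
  have hKi : Integrable (fun x : ℝ => Real.exp (0 * x + 1 / 4 * x ^ 2)) (gaussianReal 0 1) :=
    integrable_exp_quadratic_stdGaussian 0 (by norm_num)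
  set g := (gaussianReal 0 1).real (Set.Icc 0 1) with hg
  have hg0 : 0 < g := stdGaussian_real_Icc_pos zero_lt_one
  have hK0 : 0 ≤ K := integral_nonneg fun x => (Real.exp_pos _).le
  refine ⟨1 + K / g, by positivity, fun N hN => ?_⟩
  have hN1 : (1 : ℝ) ≤ N := by exact_mod_cast hN
  have hs : 1 ≤ √(N : ℝ) := Real.one_le_sqrt.mpr hN1
  have hs2 : √(N : ℝ) ^ 2 = N := Real.sq_sqrt (by positivity)
  set Q := Set.Icc (-(4 * √(N : ℝ))) (4 * √N) with hQ
  set f := fun x : ℝ => Real.cosh (1 / √N * x) ^ N with hf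
  have hfi : Integrable f (gaussianReal 0 1) := integrable_cosh_pow _ _
  have hQm : MeasurableSet Q := measurableSet_Icc
  have h1 : ∫ x, f x ∂(gaussianReal 0 1) ≤ (∫ x in Q, f x ∂(gaussianReal 0 1)) + K := by
    rw [← integral_indicator hQm, hK, ← integral_add (hfi.indicator hQm) hKi]
    refine integral_mono hfi ((hfi.indicator hQm).add hKi) fun x => ?_
    by_cases hx : x ∈ Q
    · simp only [Set.indicator_of_mem hx]
      linarith [Real.exp_pos (0 * x + 1 / 4 * x ^ 2)]
    · simp only [Set.indicator_of_notMem hx, zero_add]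
      have hx4 : 4 ≤ |1 / √N * x| := by
        rw [abs_mul, abs_of_pos (by positivity), one_div, ← div_eq_inv_mul,
          le_div_iff₀ (by positivity)]
        by_contra hlt
        exact hx (Set.mem_Icc.mpr (abs_le.mp (le_of_not_ge hlt)))
      calc f x ≤ Real.exp |1 / √N * x| ^ N := by
            simp only [hf]; gcongr; exact cosh_le_exp_abs _
        _ ≤ Real.exp ((1 / √N * x) ^ 2 / 4) ^ N := by
            gcongr
            rw [← sq_abs]; nlinarith
        _ = Real.exp (0 * x + 1 / 4 * x ^ 2) := by
            rw [← Real.exp_nat_mul, mul_pow, div_pow, hs2]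
            congr 1
            field_simp
            ring
  have h2 : g ≤ ∫ x in Q, f x ∂(gaussianReal 0 1) := by
    have hsub : Set.Icc (0 : ℝ) 1 ⊆ Q := Set.Icc_subset_Icc (by linarith) (by linarith)
    calc g = ∫ x in Set.Icc (0 : ℝ) 1, (1 : ℝ) ∂(gaussianReal 0 1) := by simp [hg]
      _ ≤ ∫ x in Set.Icc (0 : ℝ) 1, f x ∂(gaussianReal 0 1) :=
          setIntegral_mono (by simp) hfi.integrableOn fun x =>
            one_le_pow₀ (Real.one_le_cosh _)
      _ ≤ _ := setIntegral_mono_set hfi.integrableOn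
          (ae_of_all _ fun x => by simp only [hf]; positivity) hsub.eventuallyLE
  have h3 : K ≤ K / g * ∫ x in Q, f x ∂(gaussianReal 0 1) := by
    rw [div_mul_eq_mul_div, le_div_iff₀ hg0]
    gcongr
  linarith

/-- The latent field of a critical mode is of order `N ^ (-1/4)` after normalisation by `√N`
with probability bounded below: the quadratic terms of its density cancel, and the density is
comparable to `exp (-c x ^ 4 / N)`. -/
theorem exists_integral_cosh_pow_le_setIntegral_Icc_sqrt_sqrt :
    ∃ C : ℝ, 0 < C ∧ ∀ N : ℕ, 0 < N →
      ∫ x, Real.cosh (1 / √N * x) ^ N ∂(gaussianReal 0 1) ≤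
        C * ∫ x in Set.Icc (√√N / 2) (√√N), Real.cosh (1 / √N * x) ^ N
          ∂(gaussianReal 0 1) := by
  refine ⟨24 * Real.pi, by positivity, fun N hN => ?_⟩
  have hN1 : (1 : ℝ) ≤ N := by exact_mod_cast hN
  have hs2 : √(N : ℝ) ^ 2 = N := Real.sq_sqrt (by positivity)
  have hs0 : 0 < √(N : ℝ) := by positivity
  set w := √√(N : ℝ) with hw
  have hw2 : w ^ 2 = √N := Real.sq_sqrt (by positivity)
  have hw4 : w ^ 4 = N := by rw [show w ^ 4 = (w ^ 2) ^ 2 by ring, hw2, hs2]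
  have hw0 : 0 < w := by positivity
  set f := fun x : ℝ => Real.cosh (1 / √N * x) ^ N with hf
  have hfi : Integrable f (gaussianReal 0 1) := integrable_cosh_pow _ _
  have hfv : Integrable (fun x => Real.exp (-(x ^ 2 / 2)) * f x) :=
    (integrable_stdGaussian_iff f).mp hfi
  have hQm : MeasurableSet (Set.Icc (w / 2) w) := measurableSet_Icc
  have hform : ∀ x, Real.exp (-(x ^ 2 / 2)) * f x =
      (Real.exp (-((1 / √N * x) ^ 2 / 2)) * Real.cosh (1 / √N * x)) ^ N := fun x => by
    rw [mul_pow, ← Real.exp_nat_mul]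
    congr 2
    rw [mul_pow, div_pow, hs2]
    field_simp
  have hu4 : ∀ x, (1 / √N * x) ^ 4 = (x / w) ^ 4 / N := fun x => by
    rw [mul_pow, div_pow, div_pow, hw4, show √(N : ℝ) ^ 4 = (√(N : ℝ) ^ 2) ^ 2 by ring, hs2]
    field_simp
  have hup : ∀ x, Real.exp (-(x ^ 2 / 2)) * f x ≤ 9 * (1 + (x / w) ^ 2)⁻¹ := fun x => by
    rw [hform]
    set u := 1 / √N * x with hu
    have h1 : Real.exp (-(u ^ 2 / 2)) * Real.cosh u ≤ (1 + u ^ 4 / 32)⁻¹ := by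
      rw [Real.exp_neg, ← div_eq_inv_mul, div_le_iff₀ (Real.exp_pos _), ← div_eq_inv_mul,
        le_div_iff₀ (by positivity)]
      exact cosh_mul_one_add_le u
    calc _ ≤ ((1 + u ^ 4 / 32)⁻¹) ^ N := by gcongr
      _ ≤ (1 + (x / w) ^ 4 / 32)⁻¹ := by
          rw [inv_pow]
          gcongr
          have := one_add_mul_le_pow (a := u ^ 4 / 32) (by linarith [show 0 ≤ u ^ 4 / 32 by positivity]) N
          rw [hu4] at this ⊢
          refine le_trans (le_of_eq ?_) this
          field_simp
      _ ≤ 9 * (1 + (x / w) ^ 2)⁻¹ := by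
          rw [← div_eq_mul_inv, inv_eq_one_div, div_le_div_iff₀ (by positivity) (by positivity)]
          nlinarith [sq_nonneg ((x / w) ^ 2 - 16)]
  have hlow : ∀ x ∈ Set.Icc (w / 2) w, 3 / 4 ≤ Real.exp (-(x ^ 2 / 2)) * f x := fun x hx => by
    rw [hform]
    have hx0 : 0 ≤ x / w := div_nonneg (by linarith [hx.1]) hw0.le
    have hx1 : x / w ≤ 1 := (div_le_one hw0).mpr hx.2
    have hx4 : (x / w) ^ 4 ≤ 1 := pow_le_one₀ hx0 hx1
    have hNx : (x / w) ^ 4 / N ≤ 1 := (div_le_one (by positivity)).mpr (by linarith)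
    have h1 := one_sub_le_exp_mul_cosh (1 / √N * x)
    have h2 := one_add_mul_le_pow (a := -((1 / √N * x) ^ 4 / 4)) (by rw [hu4]; linarith) N
    have h3 : 1 + (N : ℝ) * -((1 / √N * x) ^ 4 / 4) = 1 - (x / w) ^ 4 / 4 := by
      rw [hu4]; field_simp; ring
    calc (3 : ℝ) / 4 ≤ 1 + (N : ℝ) * -((1 / √N * x) ^ 4 / 4) := by rw [h3]; linarith
      _ ≤ _ := h2
      _ ≤ _ := by
        gcongr
        · rw [hu4]; linarith
        · linarith
  have hi : Integrable fun x : ℝ => 9 * (1 + (x / w) ^ 2)⁻¹ :=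
    (integrable_inv_one_add_sq.comp_div hw0.ne').const_mul 9
  have hk : 0 < (√(2 * Real.pi))⁻¹ := by positivity
  have hA : ∫ x, f x ∂(gaussianReal 0 1) ≤ (√(2 * Real.pi))⁻¹ * (9 * (w * Real.pi)) := by
    rw [integral_stdGaussian]
    gcongr
    refine (integral_mono hfv hi hup).trans (le_of_eq ?_)
    rw [integral_const_mul, Measure.integral_comp_div (fun x : ℝ => (1 + x ^ 2)⁻¹),
      integral_univ_inv_one_add_sq, abs_of_pos hw0, smul_eq_mul]
  have hB : (√(2 * Real.pi))⁻¹ * (3 / 4 * (w / 2)) ≤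
      ∫ x in Set.Icc (w / 2) w, f x ∂(gaussianReal 0 1) := by
    rw [← integral_indicator hQm, integral_stdGaussian]
    gcongr
    have : ∀ x, Real.exp (-(x ^ 2 / 2)) * (Set.Icc (w / 2) w).indicator f x =
        (Set.Icc (w / 2) w).indicator (fun x => Real.exp (-(x ^ 2 / 2)) * f x) x := fun x => by
      by_cases hx : x ∈ Set.Icc (w / 2) w <;> simp only [Set.indicator_of_mem,
        Set.indicator_of_notMem, hx, not_false_eq_true, mul_zero]
    simp_rw [this]
    rw [integral_indicator hQm]
    calc 3 / 4 * (w / 2) = ∫ x in Set.Icc (w / 2) w, (3 / 4 : ℝ) := by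
          rw [setIntegral_const, measureReal_def, Real.volume_Icc,
            ENNReal.toReal_ofReal (by linarith), smul_eq_mul]
          ring
      _ ≤ _ := setIntegral_mono_on (by simp) hfv.integrableOn hQm hlow
  calc _ ≤ _ := hA
    _ = 24 * Real.pi * ((√(2 * Real.pi))⁻¹ * (3 / 4 * (w / 2))) := by ring
    _ ≤ _ := by gcongr

/-- The Gibbs weight of the two latent fields `u` and `v`, which act on the two blocks of size `m`
as the external fields `u + v` and `u - v`. -/
noncomputable def latentWeight (m : ℕ) (u v : ℝ) : ℝ := (Real.cosh (u + v) * Real.cosh (u - v)) ^ m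

/-- Half the difference of the mean spins of the two blocks in the external fields `u + v` and
`u - v`. -/
noncomputable def blockGap (u v : ℝ) : ℝ := (Real.tanh (u + v) - Real.tanh (u - v)) / 2

theorem latentWeight_pos (m : ℕ) (u v : ℝ) : 0 < latentWeight m u v :=
  pow_pos (mul_pos (Real.cosh_pos _) (Real.cosh_pos _)) _

theorem latentWeight_comm (m : ℕ) (u v : ℝ) : latentWeight m u v = latentWeight m v u := by
  rw [latentWeight, latentWeight, add_comm, ← Real.cosh_neg (u - v), neg_sub]

theorem cosh_pow_le_latentWeight (m : ℕ) (u v : ℝ) :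
    Real.cosh u ^ (2 * m) ≤ latentWeight m u v := by
  rw [latentWeight, cosh_add_mul_cosh_sub, pow_mul]
  gcongr
  linarith [sq_nonneg (Real.sinh v)]

theorem latentWeight_le (m : ℕ) (u v : ℝ) :
    latentWeight m u v ≤ Real.cosh u ^ (2 * m) * Real.exp (m * v ^ 2) := by
  have h1 : Real.cosh u ^ 2 + Real.sinh v ^ 2 ≤ Real.cosh u ^ 2 * Real.cosh v ^ 2 := by
    rw [Real.cosh_sq v]
    nlinarith [sq_nonneg (Real.sinh v), one_le_pow₀ (Real.one_le_cosh u) (n := 2)]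
  rw [latentWeight, cosh_add_mul_cosh_sub, pow_mul, Real.exp_nat_mul, ← mul_pow]
  have h2 : Real.cosh v ^ 2 ≤ Real.exp (v ^ 2) := by
    calc Real.cosh v ^ 2 ≤ Real.exp (v ^ 2 / 2) ^ 2 := by
          gcongr; exact Real.cosh_le_exp_half_sq v
      _ = _ := by rw [← Real.exp_nat_mul]; congr 1; push_cast; ring
  gcongr
  exact h1.trans (by gcongr)

/-- A mean with respect to the latent weight is bounded below by the mean over a window of the
critical field `x.1`; the subcritical field `x.2` is tight, uniformly in the critical one. -/
theorem mul_integral_latentWeight_le (m : ℕ) {p r b q C : ℝ} (hr : m * r ^ 2 ≤ b / 2)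
    (hb : b < 1) (hC : 0 < C) (hq : 0 ≤ q) {Q : Set ℝ} (hQm : MeasurableSet Q) {f : ℝ × ℝ → ℝ}
    (hf0 : ∀ x, 0 ≤ f x)
    (hQ : ∀ x ∈ Q, ∀ y ∈ Set.Icc (1 : ℝ) 2, q ≤ f (x, y))
    (hfi : Integrable (fun x : ℝ × ℝ => latentWeight m (p * x.1) (r * x.2) * f x)
      ((gaussianReal 0 1).prod (gaussianReal 0 1)))
    (hcrit : ∫ x, Real.cosh (p * x) ^ (2 * m) ∂(gaussianReal 0 1) ≤
      C * ∫ x in Q, Real.cosh (p * x) ^ (2 * m) ∂(gaussianReal 0 1)) :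
    (gaussianReal 0 1).real (Set.Icc 1 2) * √(1 - b) / C * q *
        ∫ x : ℝ × ℝ, latentWeight m (p * x.1) (r * x.2)
          ∂((gaussianReal 0 1).prod (gaussianReal 0 1)) ≤
      ∫ x : ℝ × ℝ, latentWeight m (p * x.1) (r * x.2) * f x
        ∂((gaussianReal 0 1).prod (gaussianReal 0 1)) := by
  set g := fun x : ℝ => Real.cosh (p * x) ^ (2 * m) with hg
  have hgi : Integrable g (gaussianReal 0 1) := integrable_cosh_pow _ _
  have hei : Integrable (fun x : ℝ => Real.exp (0 * x + b / 2 * x ^ 2)) (gaussianReal 0 1) :=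
    integrable_exp_quadratic_stdGaussian 0 (by linarith)
  have hb1 : 0 < 1 - b := by linarith
  have hW : ∀ x : ℝ × ℝ, latentWeight m (p * x.1) (r * x.2) ≤
      g x.1 * Real.exp (0 * x.2 + b / 2 * x.2 ^ 2) := fun x => by
    refine (latentWeight_le m _ _).trans ?_
    gcongr
    rw [mul_pow, ← mul_assoc, zero_mul, zero_add]
    gcongr
  have hup : ∫ x : ℝ × ℝ, latentWeight m (p * x.1) (r * x.2)
        ∂((gaussianReal 0 1).prod (gaussianReal 0 1)) ≤
      (∫ x, g x ∂(gaussianReal 0 1)) * √(1 / (1 - b)) := by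
    refine (integral_mono_of_nonneg (ae_of_all _ fun x => (latentWeight_pos _ _ _).le)
      (hgi.mul_prod hei) (ae_of_all _ hW)).trans (le_of_eq ?_)
    rw [integral_prod_mul g (fun x => Real.exp (0 * x + b / 2 * x ^ 2)), integral_exp_quadratic_stdGaussian 0 (by linarith)]
    congr 1
    norm_num
    congr 2
    ring
  have hlow : q * (gaussianReal 0 1).real (Set.Icc 1 2) * ∫ x in Q, g x ∂(gaussianReal 0 1) ≤
      ∫ x : ℝ × ℝ, latentWeight m (p * x.1) (r * x.2) * f x
        ∂((gaussianReal 0 1).prod (gaussianReal 0 1)) := by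
    have hi2 : Integrable ((Set.Icc (1 : ℝ) 2).indicator fun _ => (1 : ℝ)) (gaussianReal 0 1) :=
      (integrable_const 1).indicator measurableSet_Icc
    have hi1 := hgi.indicator hQm
    calc _ = ∫ x : ℝ × ℝ, q * (Q.indicator g x.1 *
            (Set.Icc (1 : ℝ) 2).indicator (fun _ => (1 : ℝ)) x.2)
          ∂((gaussianReal 0 1).prod (gaussianReal 0 1)) := by
          rw [integral_const_mul, integral_prod_mul (Q.indicator g), integral_indicator hQm,
            integral_indicator measurableSet_Icc]
          simp
          ring
      _ ≤ _ := by
          refine integral_mono ((hi1.mul_prod hi2).const_mul q) hfi fun x => ?_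
          simp only
          have hpos := mul_nonneg (latentWeight_pos m (p * x.1) (r * x.2)).le (hf0 x)
          by_cases h1 : x.1 ∈ Q
          · by_cases h2 : x.2 ∈ Set.Icc (1 : ℝ) 2
            · rw [Set.indicator_of_mem h1, Set.indicator_of_mem h2, mul_one, mul_comm]
              exact mul_le_mul (cosh_pow_le_latentWeight _ _ _) (hQ _ h1 _ h2) hq
                (latentWeight_pos _ _ _).le
            · rw [Set.indicator_of_notMem h2, mul_zero, mul_zero]; exact hpos
          · rw [Set.indicator_of_notMem h1, zero_mul, mul_zero]; exact hpos
  set P := (gaussianReal 0 1).real (Set.Icc 1 2) with hP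
  have hP0 : 0 ≤ P := measureReal_nonneg
  calc _ ≤ P * √(1 - b) / C * q * ((C * ∫ x in Q, g x ∂(gaussianReal 0 1)) * √(1 / (1 - b))) := by
        gcongr
        exact hup.trans (by gcongr)
    _ = q * P * (∫ x in Q, g x ∂(gaussianReal 0 1)) * (√(1 - b) * √(1 / (1 - b))) := by
        field_simp
    _ = q * P * ∫ x in Q, g x ∂(gaussianReal 0 1) := by
        rw [← Real.sqrt_mul hb1.le, mul_one_div_cancel hb1.ne', Real.sqrt_one, mul_one]
    _ ≤ _ := hlow

theorem blockGap_eq (u v : ℝ) :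
    blockGap u v = Real.sinh (2 * v) / (2 * (Real.cosh (u + v) * Real.cosh (u - v))) := by
  have h1 := (Real.cosh_pos (u + v)).ne'
  have h2 := (Real.cosh_pos (u - v)).ne'
  rw [blockGap, Real.tanh_eq_sinh_div_cosh, Real.tanh_eq_sinh_div_cosh, div_sub_div _ _ h1 h2,
    show 2 * v = (u + v) - (u - v) by ring, Real.sinh_sub (u + v)]
  field_simp

theorem div_cosh_sq_le_blockGap {u v K : ℝ} (hv : 0 ≤ v) (h1 : |u + v| ≤ K) (h2 : |u - v| ≤ K) :
    v / Real.cosh K ^ 2 ≤ blockGap u v := by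
  rw [blockGap_eq, div_le_div_iff₀ (by positivity) (by positivity)]
  have h3 : 2 * v ≤ Real.sinh (2 * v) := Real.self_le_sinh_iff.mpr (by positivity)
  have h4 : Real.cosh (u + v) ≤ Real.cosh K := Real.cosh_le_cosh.mpr (h1.trans (le_abs_self K))
  have h5 : Real.cosh (u - v) ≤ Real.cosh K := Real.cosh_le_cosh.mpr (h2.trans (le_abs_self K))
  have h6 : Real.cosh (u + v) * Real.cosh (u - v) ≤ Real.cosh K ^ 2 := by
    rw [sq]; gcongr
  calc v * (2 * (Real.cosh (u + v) * Real.cosh (u - v)))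
      = 2 * v * (Real.cosh (u + v) * Real.cosh (u - v)) := by ring
    _ ≤ Real.sinh (2 * v) * Real.cosh K ^ 2 := by gcongr

theorem blockGap_sq_le_one (u v : ℝ) : blockGap u v ^ 2 ≤ 1 := by
  rw [sq_le_one_iff_abs_le_one, abs_le, blockGap]
  have h1 := Real.tanh_lt_one (u + v)
  have h2 := Real.tanh_lt_one (u - v)
  have h3 := Real.neg_one_lt_tanh (u + v)
  have h4 := Real.neg_one_lt_tanh (u - v)
  constructor <;> linarith

theorem continuous_real_tanh : Continuous Real.tanh := by
  have : Real.tanh = fun x => Real.sinh x / Real.cosh x := by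
    ext x; exact Real.tanh_eq_sinh_div_cosh x
  rw [this]
  exact Real.continuous_sinh.div Real.continuous_cosh fun x => (Real.cosh_pos x).ne'

theorem continuous_blockGap (p r : ℝ) :
    Continuous fun x : ℝ × ℝ => blockGap (p * x.1) (r * x.2) := by
  unfold blockGap
  have h1 := continuous_real_tanh.comp
    (show Continuous fun x : ℝ × ℝ => p * x.1 + r * x.2 by fun_prop)
  have h2 := continuous_real_tanh.comp
    (show Continuous fun x : ℝ × ℝ => p * x.1 - r * x.2 by fun_prop)
  exact (h1.sub h2).div_const 2

theorem continuous_latentWeight (m : ℕ) (p r : ℝ) :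
    Continuous fun x : ℝ × ℝ => latentWeight m (p * x.1) (r * x.2) := by
  unfold latentWeight
  fun_prop

theorem integrable_latentWeight (m : ℕ) (p r : ℝ) :
    Integrable (fun x : ℝ × ℝ => latentWeight m (p * x.1) (r * x.2))
      ((gaussianReal 0 1).prod (gaussianReal 0 1)) := by
  refine ((integrable_exp_mul_abs_stdGaussian (m * (2 * |p|))).mul_prod
    (integrable_exp_mul_abs_stdGaussian (m * (2 * |r|)))).mono'
    (continuous_latentWeight m p r).aestronglyMeasurable (ae_of_all _ fun x => ?_)
  rw [Real.norm_of_nonneg (latentWeight_pos _ _ _).le, latentWeight, mul_assoc (m : ℝ),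
    mul_assoc (m : ℝ), Real.exp_nat_mul, Real.exp_nat_mul, ← mul_pow, ← Real.exp_add]
  gcongr
  refine (mul_le_mul (cosh_le_exp_abs _) (cosh_le_exp_abs _) (Real.cosh_pos _).le
    (Real.exp_pos _).le).trans ?_
  rw [← Real.exp_add, mul_assoc, mul_assoc, ← abs_mul, ← abs_mul, Real.exp_le_exp]
  linarith [abs_add_le (p * x.1) (r * x.2), abs_sub (p * x.1) (r * x.2)]

theorem integrable_latentWeight_mul (m : ℕ) (p r : ℝ) {f : ℝ × ℝ → ℝ} (hf : Continuous f)
    (h1 : ∀ x, |f x| ≤ 1) :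
    Integrable (fun x : ℝ × ℝ => latentWeight m (p * x.1) (r * x.2) * f x)
      ((gaussianReal 0 1).prod (gaussianReal 0 1)) :=
  (integrable_latentWeight m p r).mul_bdd hf.aestronglyMeasurable
    (ae_of_all _ fun x => by simpa using h1 x)

/-- For `α > 0` the total magnetisation is critical and the difference of the block magnetisations
is subcritical, so the block means differ by a quantity of order `N ^ (-1/2)`. -/
theorem exists_blockGap_lower_bound_of_magnetisation_critical {b : ℝ} (hb0 : 0 < b)
    (hb1 : b < 1) :
    ∃ c : ℝ, 0 < c ∧ ∀ m : ℕ, 0 < m →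
      c * (1 / ((2 * m : ℕ) : ℝ)) *
        ∫ x : ℝ × ℝ, latentWeight m (√(1 / (2 * m : ℕ)) * x.1) (√(b / (2 * m : ℕ)) * x.2)
          ∂((gaussianReal 0 1).prod (gaussianReal 0 1)) ≤
      ∫ x : ℝ × ℝ, latentWeight m (√(1 / (2 * m : ℕ)) * x.1) (√(b / (2 * m : ℕ)) * x.2) *
          blockGap (√(1 / (2 * m : ℕ)) * x.1) (√(b / (2 * m : ℕ)) * x.2) ^ 2
        ∂((gaussianReal 0 1).prod (gaussianReal 0 1)) := by
  obtain ⟨C, hC, hCN⟩ := exists_integral_cosh_pow_le_setIntegral_Icc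
  have hP := stdGaussian_real_Icc_pos (show (1 : ℝ) < 2 by norm_num)
  have hs : 0 < √(1 - b) := Real.sqrt_pos.mpr (by linarith)
  refine ⟨(gaussianReal 0 1).real (Set.Icc 1 2) * √(1 - b) / C * (b / Real.cosh 6 ^ 4),
    by positivity, fun m hm => ?_⟩
  have hN : 0 < 2 * m := by omega
  have hcrit := hCN (2 * m) hN
  rw [show 1 / √((2 * m : ℕ) : ℝ) = √(1 / (2 * m : ℕ)) by simp] at hcrit
  set N : ℝ := ((2 * m : ℕ) : ℝ) with hNdef
  have hN2 : (2 : ℝ) ≤ N := by rw [hNdef]; exact_mod_cast (by omega : 2 ≤ 2 * m)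
  have hNm : N = 2 * m := by rw [hNdef]; push_cast; ring
  have hr2 : √(b / N) ^ 2 = b / N := Real.sq_sqrt (by positivity)
  have hr1 : √(b / N) ≤ 1 := by
    rw [Real.sqrt_le_one, div_le_one (by positivity)]; linarith
  have hps : √(1 / N) * √N = 1 := by
    rw [← Real.sqrt_mul (by positivity), one_div_mul_cancel (by positivity), Real.sqrt_one]
  have := mul_integral_latentWeight_le m (p := √(1 / N)) (r := √(b / N)) (b := b)
    (q := b / Real.cosh 6 ^ 4 * (1 / N)) (C := C)
    (Q := Set.Icc (-(4 * √N)) (4 * √N))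
    (f := fun x => blockGap (√(1 / N) * x.1) (√(b / N) * x.2) ^ 2)
    (by rw [hr2, hNm]; field_simp; rfl) hb1 hC (by positivity) measurableSet_Icc
    (fun x => sq_nonneg _) (fun x hx y hy => ?_)
    (integrable_latentWeight_mul m _ _ ((continuous_blockGap _ _).pow 2) fun x => by
      rw [abs_of_nonneg (sq_nonneg _)]; exact blockGap_sq_le_one _ _) hcrit
  · refine le_trans (le_of_eq ?_) this
    ring
  · have hu : |√(1 / N) * x| ≤ 4 := by
      rw [abs_mul, abs_of_nonneg (Real.sqrt_nonneg _)]
      calc √(1 / N) * |x| ≤ √(1 / N) * (4 * √N) := by gcongr; exact abs_le.mpr hx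
        _ = 4 := by linear_combination 4 * hps
    have hv0 : 0 ≤ √(b / N) * y := mul_nonneg (Real.sqrt_nonneg _) (by linarith [hy.1])
    have hv : |√(b / N) * y| ≤ 2 := by
      rw [abs_of_nonneg hv0]
      nlinarith [hy.1, hy.2, Real.sqrt_nonneg (b / N)]
    have h1 := div_cosh_sq_le_blockGap (u := √(1 / N) * x) (K := 6) hv0
      ((abs_add_le _ _).trans (by linarith)) ((abs_sub _ _).trans (by linarith))
    calc b / Real.cosh 6 ^ 4 * (1 / N) = (√(b / N) * 1 / Real.cosh 6 ^ 2) ^ 2 := by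
          rw [div_pow, mul_one, hr2]; ring
      _ ≤ (√(b / N) * y / Real.cosh 6 ^ 2) ^ 2 := by gcongr; exact hy.1
      _ ≤ _ := by gcongr

/-- For `α < 0` the difference of the block magnetisations is critical, so the block means differ
by a quantity of order `N ^ (-1/4)`. -/
theorem exists_blockGap_lower_bound_of_difference_critical {a : ℝ} (ha0 : 0 ≤ a)
    (ha1 : a < 1) :
    ∃ c : ℝ, 0 < c ∧ ∀ m : ℕ, 0 < m →
      c * (1 / √((2 * m : ℕ) : ℝ)) *
        ∫ x : ℝ × ℝ, latentWeight m (√(a / (2 * m : ℕ)) * x.1) (√(1 / (2 * m : ℕ)) * x.2)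
          ∂((gaussianReal 0 1).prod (gaussianReal 0 1)) ≤
      ∫ x : ℝ × ℝ, latentWeight m (√(a / (2 * m : ℕ)) * x.1) (√(1 / (2 * m : ℕ)) * x.2) *
          blockGap (√(a / (2 * m : ℕ)) * x.1) (√(1 / (2 * m : ℕ)) * x.2) ^ 2
        ∂((gaussianReal 0 1).prod (gaussianReal 0 1)) := by
  obtain ⟨C, hC, hCN⟩ := exists_integral_cosh_pow_le_setIntegral_Icc_sqrt_sqrt
  have hP := stdGaussian_real_Icc_pos (show (1 : ℝ) < 2 by norm_num)
  have hs : 0 < √(1 - a) := Real.sqrt_pos.mpr (by linarith)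
  refine ⟨(gaussianReal 0 1).real (Set.Icc 1 2) * √(1 - a) / C * (1 / (4 * Real.cosh 3 ^ 4)),
    by positivity, fun m hm => ?_⟩
  have hN : 0 < 2 * m := by omega
  have hcrit := hCN (2 * m) hN
  rw [show 1 / √((2 * m : ℕ) : ℝ) = √(1 / (2 * m : ℕ)) by simp] at hcrit
  set N : ℝ := ((2 * m : ℕ) : ℝ) with hNdef
  have hN2 : (2 : ℝ) ≤ N := by rw [hNdef]; exact_mod_cast (by omega : 2 ≤ 2 * m)
  have hNm : N = 2 * m := by rw [hNdef]; push_cast; ring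
  have hr2 : √(a / N) ^ 2 = a / N := Real.sq_sqrt (by positivity)
  have hp2 : √(1 / N) ^ 2 = 1 / N := Real.sq_sqrt (by positivity)
  have hr1 : √(a / N) ≤ 1 := by
    rw [Real.sqrt_le_one, div_le_one (by positivity)]; linarith
  have hps : √(1 / N) * √N = 1 := by
    rw [← Real.sqrt_mul (by positivity), one_div_mul_cancel (by positivity), Real.sqrt_one]
  have hw2 : √√N ^ 2 = √N := Real.sq_sqrt (by positivity)
  have hw1 : √√N ≤ √N := by
    rw [Real.sqrt_le_left (Real.sqrt_nonneg _), Real.sq_sqrt (by positivity),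
      Real.sqrt_le_left (by positivity)]
    nlinarith
  -- The critical field is the second coordinate here.
  rw [← integral_prod_swap, ← integral_prod_swap (fun x : ℝ × ℝ => latentWeight m
    (√(a / N) * x.1) (√(1 / N) * x.2) * blockGap (√(a / N) * x.1) (√(1 / N) * x.2) ^ 2)]
  simp only [Prod.fst_swap, Prod.snd_swap]
  simp_rw [latentWeight_comm m (√(a / N) * _)]
  have := mul_integral_latentWeight_le m (p := √(1 / N)) (r := √(a / N)) (b := a)
    (q := 1 / (4 * Real.cosh 3 ^ 4) * (1 / √N)) (C := C)
    (Q := Set.Icc (√√N / 2) (√√N))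
    (f := fun x => blockGap (√(a / N) * x.2) (√(1 / N) * x.1) ^ 2)
    (by rw [hr2, hNm]; field_simp; rfl) ha1 hC (by positivity) measurableSet_Icc
    (fun x => sq_nonneg _) (fun x hx y hy => ?_)
    (integrable_latentWeight_mul m _ _
      (((continuous_blockGap _ _).comp continuous_swap).pow 2) fun x => by
      rw [abs_of_nonneg (sq_nonneg _)]; exact blockGap_sq_le_one _ _) hcrit
  · refine le_trans (le_of_eq ?_) this
    ring
  · have hw0 : 0 ≤ √√N := Real.sqrt_nonneg _
    have hx0 : 0 ≤ x := le_trans (by positivity) hx.1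
    have hv0 : 0 ≤ √(1 / N) * x := mul_nonneg (Real.sqrt_nonneg _) hx0
    have hv : |√(1 / N) * x| ≤ 1 := by
      rw [abs_of_nonneg hv0]
      exact (mul_le_mul_of_nonneg_left (hx.2.trans hw1) (Real.sqrt_nonneg _)).trans_eq hps
    have hu : |√(a / N) * y| ≤ 2 := by
      rw [abs_of_nonneg (mul_nonneg (Real.sqrt_nonneg _) (by linarith [hy.1]))]
      nlinarith [hy.1, hy.2, Real.sqrt_nonneg (a / N)]
    have h1 := div_cosh_sq_le_blockGap (u := √(a / N) * y) (K := 3) hv0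
      ((abs_add_le _ _).trans (by linarith)) ((abs_sub _ _).trans (by linarith))
    calc 1 / (4 * Real.cosh 3 ^ 4) * (1 / √N)
          = (√(1 / N) * (√√N / 2) / Real.cosh 3 ^ 2) ^ 2 := by
          rw [div_pow, mul_pow, div_pow, hp2, hw2]
          have h3 : √N ^ 2 = N := Real.sq_sqrt (by positivity)
          have h4 : 0 < √N := by positivity
          field_simp
          rw [h3]; ring
      _ ≤ (√(1 / N) * x / Real.cosh 3 ^ 2) ^ 2 := by gcongr; exact hx.1
      _ ≤ _ := by gcongr

/-! ### Independent spins in an external field -/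

/-- The law of independent spins, the spin `i` being subject to the external field `h i`. -/
noncomputable def fieldWeight {ι : Type*} [Fintype ι] (h : ι → ℝ) (σ : ι → Bool) : ℝ :=
  ∏ i, Real.exp (h i * spin (σ i)) / (2 * Real.cosh (h i))

theorem fieldWeight_nonneg {ι : Type*} [Fintype ι] (h : ι → ℝ) (σ : ι → Bool) :
    0 ≤ fieldWeight h σ :=
  Finset.prod_nonneg fun _ _ => by positivity

theorem sum_prod_pi {ι κ : Type*} [Fintype ι] [DecidableEq ι] [Fintype κ] (f : ι → κ → ℝ) :
    ∑ σ : ι → κ, ∏ i, f i (σ i) = ∏ i, ∑ b, f i b := by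
  have := (Finset.prod_univ_sum (fun _ : ι => (Finset.univ : Finset κ)) f).symm
  rwa [Fintype.piFinset_univ] at this

theorem sum_prod_bool {ι : Type*} [Fintype ι] [DecidableEq ι] (f : ι → Bool → ℝ) :
    ∑ σ : ι → Bool, ∏ i, f i (σ i) = ∏ i, (f i true + f i false) := by
  simp_rw [sum_prod_pi, Fintype.sum_bool]

theorem sum_fieldWeight {ι : Type*} [Fintype ι] [DecidableEq ι] (h : ι → ℝ) :
    ∑ σ : ι → Bool, fieldWeight h σ = 1 := by
  unfold fieldWeight
  rw [sum_prod_bool fun i b => Real.exp (h i * spin b) / (2 * Real.cosh (h i))]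
  refine Finset.prod_eq_one fun i _ => ?_
  have := (Real.cosh_pos (h i)).ne'
  rw [← add_div, div_eq_one_iff_eq (by positivity), Real.cosh_eq]
  simp [spin]
  ring

theorem sum_fieldWeight_mul_exp_le {ι : Type*} [Fintype ι] [DecidableEq ι] (h e : ι → ℝ)
    (he : ∀ i, e i = 1 ∨ e i = -1) (l : ℝ) :
    ∑ σ : ι → Bool, fieldWeight h σ * Real.exp (l * ∑ i, e i * spin (σ i)) ≤
      Real.exp (l * (∑ i, e i * Real.tanh (h i)) + Fintype.card ι * l ^ 2 / 2) := by
  have hr : Real.exp (l * (∑ i, e i * Real.tanh (h i)) + Fintype.card ι * l ^ 2 / 2) =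
      ∏ i, Real.exp (l * (e i * Real.tanh (h i)) + l ^ 2 / 2) := by
    rw [← Real.exp_sum, Finset.sum_add_distrib, ← Finset.mul_sum]
    simp
    ring
  have hl : ∀ σ : ι → Bool, fieldWeight h σ * Real.exp (l * ∑ i, e i * spin (σ i)) =
      ∏ i, (Real.exp (h i * spin (σ i)) / (2 * Real.cosh (h i)) *
        Real.exp (l * (e i * spin (σ i)))) := fun σ => by
    rw [Finset.prod_mul_distrib, ← Real.exp_sum, ← Finset.mul_sum]; rfl
  simp_rw [hl]
  rw [sum_prod_bool fun i b => Real.exp (h i * spin b) / (2 * Real.cosh (h i)) *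
    Real.exp (l * (e i * spin b)), hr]
  refine Finset.prod_le_prod (fun i _ => by positivity) fun i _ => ?_
  have hc := Real.cosh_pos (h i)
  have h1 := cosh_add_le (h i) (l * e i)
  have he2 : e i ^ 2 = 1 := by rcases he i with h | h <;> simp [h]
  rw [mul_pow, he2, mul_one] at h1
  have h2 : Real.exp (h i * spin true) / (2 * Real.cosh (h i)) * Real.exp (l * (e i * spin true)) +
      Real.exp (h i * spin false) / (2 * Real.cosh (h i)) * Real.exp (l * (e i * spin false)) =
      Real.cosh (h i + l * e i) / Real.cosh (h i) := by
    rw [Real.cosh_eq (h i + l * e i)]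
    simp only [spin, if_true, Bool.false_eq_true, if_false]
    rw [div_mul_eq_mul_div, div_mul_eq_mul_div, ← Real.exp_add, ← Real.exp_add]
    field_simp
    congr 2
    ring
  rw [h2, div_le_iff₀ hc, mul_comm (Real.exp _)]
  simpa [mul_assoc] using h1

/-- The moment generating function of the product of two independent sums of spins with drifts of
the same sign. The sum over `ι₁` is integrated out by Hoeffding's bound, which leaves the
exponential of a quadratic form in the sum over `ι₂`; a Gaussian integral linearises it. -/
theorem sum_sum_fieldWeight_mul_exp_mul_le {ι₁ ι₂ : Type*} [Fintype ι₁] [DecidableEq ι₁]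
    [Fintype ι₂] [DecidableEq ι₂] (h₁ e₁ : ι₁ → ℝ) (h₂ e₂ : ι₂ → ℝ)
    (he₁ : ∀ i, e₁ i = 1 ∨ e₁ i = -1) (he₂ : ∀ i, e₂ i = 1 ∨ e₂ i = -1) {j L g t : ℝ}
    (hj : (Fintype.card ι₁ : ℝ) = j) (hL : (Fintype.card ι₂ : ℝ) = L)
    (hm₁ : ∑ i, e₁ i * Real.tanh (h₁ i) = j * g) (hm₂ : ∑ i, e₂ i * Real.tanh (h₂ i) = L * g)
    (ht : 0 ≤ t) (hjL : j ≤ L) (htN : (j + L) * t ≤ 1 / 4) :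
    ∑ σ₁ : ι₁ → Bool, ∑ σ₂ : ι₂ → Bool, fieldWeight h₁ σ₁ * fieldWeight h₂ σ₂ *
        Real.exp (-t * ((∑ i, e₁ i * spin (σ₁ i)) * ∑ i, e₂ i * spin (σ₂ i))) ≤
      Real.exp (-(j * ((j + L) * t * g ^ 2 / 4 - (j + L) * t ^ 2))) := by
  have hj0 : 0 ≤ j := hj ▸ Nat.cast_nonneg _
  have hL0 : 0 ≤ L := hL ▸ Nat.cast_nonneg _
  have hsj : √j ^ 2 = j := Real.sq_sqrt hj0
  set V := fun σ₁ : ι₁ → Bool => ∑ i, e₁ i * spin (σ₁ i)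
  set U := fun σ₂ : ι₂ → Bool => ∑ i, e₂ i * spin (σ₂ i)
  have hjt : j * t ≤ 1 / 4 := by nlinarith
  have hLt : L * t ≤ 1 / 4 := by nlinarith
  have hjt0 : 0 ≤ j * t := by positivity
  have hLt0 : 0 ≤ L * t := by positivity
  have hexp : ∀ x : ℝ, ∀ σ₂, Real.exp (-(j * t * g) * U σ₂) * Real.exp (√j * t * U σ₂ * x) =
      Real.exp ((-(j * t * g) + √j * t * x) * U σ₂) := fun x σ₂ => by
    rw [← Real.exp_add]; congr 1; ring
  have hquad : ∀ x : ℝ, (-(j * t * g) + √j * t * x) * (L * g) +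
      L * (-(j * t * g) + √j * t * x) ^ 2 / 2 =
      (-(j * t * L * g ^ 2) + L * (j * t * g) ^ 2 / 2) +
        ((√j * t * L * g * (1 - j * t)) * x + (L * t * (j * t) / 2) * x ^ 2) := fun x => by
    linear_combination (L * t ^ 2 * x ^ 2 / 2) * hsj
  have hc2 : L * t * (j * t) / 2 ≤ 1 / 4 := by nlinarith
  calc _ = ∑ σ₂, fieldWeight h₂ σ₂ *
          ∑ σ₁, fieldWeight h₁ σ₁ * Real.exp ((-t * U σ₂) * V σ₁) := by
        rw [Finset.sum_comm]
        refine Finset.sum_congr rfl fun σ₂ _ => ?_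
        rw [Finset.mul_sum]
        refine Finset.sum_congr rfl fun σ₁ _ => ?_
        rw [show -t * (V σ₁ * U σ₂) = -t * U σ₂ * V σ₁ by ring]
        ring
    _ ≤ ∑ σ₂, fieldWeight h₂ σ₂ *
          Real.exp ((-t * U σ₂) * (j * g) + j * (-t * U σ₂) ^ 2 / 2) := by
        gcongr with σ₂
        · exact fieldWeight_nonneg _ _
        · have := sum_fieldWeight_mul_exp_le h₁ e₁ he₁ (-t * U σ₂)
          rwa [hm₁, hj] at this
    _ = ∑ σ₂, ∫ x, fieldWeight h₂ σ₂ * Real.exp ((-(j * t * g) + √j * t * x) * U σ₂)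
          ∂(gaussianReal 0 1) := by
        refine Finset.sum_congr rfl fun σ₂ _ => ?_
        rw [integral_const_mul]
        congr 1
        simp_rw [← hexp]
        rw [integral_const_mul, integral_exp_mul_stdGaussian, ← Real.exp_add]
        congr 1
        linear_combination (-(t ^ 2 * U σ₂ ^ 2) / 2) * hsj
    _ = ∫ x, ∑ σ₂, fieldWeight h₂ σ₂ * Real.exp ((-(j * t * g) + √j * t * x) * U σ₂)
          ∂(gaussianReal 0 1) := by
        rw [integral_finsetSum]
        intro σ₂ _
        simp_rw [← hexp]
        exact ((integrable_exp_mul_gaussianReal _).const_mul _).const_mul _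
    _ ≤ ∫ x, Real.exp (-(j * t * L * g ^ 2) + L * (j * t * g) ^ 2 / 2) *
          Real.exp ((√j * t * L * g * (1 - j * t)) * x + (L * t * (j * t) / 2) * x ^ 2)
          ∂(gaussianReal 0 1) := by
        refine integral_mono_of_nonneg (ae_of_all _ fun x => Finset.sum_nonneg fun σ₂ _ =>
          mul_nonneg (fieldWeight_nonneg _ _) (Real.exp_pos _).le)
          ((integrable_exp_quadratic_stdGaussian _ (by linarith)).const_mul _)
          (ae_of_all _ fun x => ?_)
        have := sum_fieldWeight_mul_exp_le h₂ e₂ he₂ (-(j * t * g) + √j * t * x)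
        rw [hm₂, hL, hquad, Real.exp_add] at this
        exact this
    _ ≤ Real.exp (-(j * t * L * g ^ 2) + L * (j * t * g) ^ 2 / 2) *
          Real.exp ((√j * t * L * g * (1 - j * t)) ^ 2 + 2 * (L * t * (j * t) / 2)) := by
        rw [integral_const_mul]
        gcongr
        exact integral_exp_quadratic_stdGaussian_le _ (by positivity) hc2
    _ ≤ _ := by
        rw [← Real.exp_add, Real.exp_le_exp]
        have h1 : (√j * t * L * g * (1 - j * t)) ^ 2 =
            (j * t * L * g ^ 2) * (L * t) * (1 - j * t) ^ 2 := by
          linear_combination (t * L * g * (1 - j * t)) ^ 2 * hsj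
        have hA : 0 ≤ j * t * L * g ^ 2 := by positivity
        have h2 : (1 - j * t) ^ 2 ≤ 1 := by nlinarith
        have h3 : (j * t * L * g ^ 2) * (L * t) * (1 - j * t) ^ 2 ≤
            (j * t * L * g ^ 2) * (1 / 4) := by
          calc _ ≤ (j * t * L * g ^ 2) * (1 / 4) * 1 := by gcongr
            _ = _ := by ring
        have h4 : L * (j * t * g) ^ 2 / 2 ≤ (j * t * L * g ^ 2) * (1 / 8) := by
          calc L * (j * t * g) ^ 2 / 2 = (j * t * L * g ^ 2) * (j * t / 2) := by ring
            _ ≤ _ := mul_le_mul_of_nonneg_left (by linarith) hA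
        have h5 : j * (j + L) * t * g ^ 2 ≤ 2 * (j * t * L * g ^ 2) := by
          have : 0 ≤ j * t * g ^ 2 := by positivity
          nlinarith
        have h6 : L * t * (j * t) ≤ j * (j + L) * t ^ 2 := by
          have : 0 ≤ j * t ^ 2 := by positivity
          nlinarith
        rw [h1]
        linarith

theorem sum_fieldWeight_mul_eq_sum_sum {ι : Type*} [Fintype ι] [DecidableEq ι] (p : ι → Prop)
    [DecidablePred p] (h : ι → ℝ) (F : ({i // p i} → Bool) → ({i // ¬p i} → Bool) → ℝ) :
    ∑ σ : ι → Bool, fieldWeight h σ * F (fun i => σ i) (fun i => σ i) =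
      ∑ σ₁ : {i // p i} → Bool, ∑ σ₂ : {i // ¬p i} → Bool,
        fieldWeight (fun i : {i // p i} => h i) σ₁ *
          fieldWeight (fun i : {i // ¬p i} => h i) σ₂ * F σ₁ σ₂ := by
  rw [← Fintype.sum_prod_type'
    (f := fun σ₁ σ₂ => fieldWeight (fun i : {i // p i} => h i) σ₁ *
          fieldWeight (fun i : {i // ¬p i} => h i) σ₂ * F σ₁ σ₂)]
  refine Fintype.sum_equiv (Equiv.piEquivPiSubtypeProd p fun _ => Bool) _ _ fun σ => ?_
  simp only [Equiv.piEquivPiSubtypeProd_apply]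
  congr 1
  unfold fieldWeight
  exact (Fintype.prod_subtype_mul_prod_subtype p
    fun i => Real.exp (h i * spin (σ i)) / (2 * Real.cosh (h i))).symm

/-! ### The Gibbs measure as a mixture of product measures -/

/-- The indicator `±1` of the two blocks: `1` on `S` and `-1` on `Sᶜ`. -/
noncomputable def blockSign {N : ℕ} (S : Finset (Fin N)) (i : Fin N) : ℝ := if i ∈ S then 1 else -1

/-- The difference of the magnetisations of the blocks `S` and `Sᶜ`. -/
noncomputable def blockDiff {N : ℕ} (S : Finset (Fin N)) (σ : Config N) : ℝ :=
  ∑ i, blockSign S i * spin (σ i)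

theorem blockSign_eq_one_or {N : ℕ} (S : Finset (Fin N)) (i : Fin N) :
    blockSign S i = 1 ∨ blockSign S i = -1 := by
  unfold blockSign; split_ifs <;> simp

theorem blockSign_compl {N : ℕ} (S : Finset (Fin N)) (i : Fin N) :
    blockSign Sᶜ i = -blockSign S i := by
  unfold blockSign; by_cases h : i ∈ S <;> simp [h]

theorem blockDiff_compl {N : ℕ} (S : Finset (Fin N)) (σ : Config N) :
    blockDiff Sᶜ σ = -blockDiff S σ := by
  simp [blockDiff, blockSign_compl]

theorem sum_blockSign {N : ℕ} {S : Finset (Fin N)} (hS : 2 * S.card = N) :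
    ∑ i, blockSign S i = 0 := by
  have h1 : ∀ i, blockSign S i = 2 * (if i ∈ S then 1 else 0) - 1 := fun i => by
    unfold blockSign; split_ifs <;> norm_num
  simp_rw [h1]
  rw [Finset.sum_sub_distrib, ← Finset.mul_sum]
  simp
  have : ((2 * S.card : ℕ) : ℝ) = N := by rw [hS]
  push_cast at this
  linarith

theorem neg_hamiltonian {N : ℕ} (α β : ℝ) (S : Finset (Fin N)) (σ : Config N) :
    -hamiltonian α β S σ =
      ((β + α) / 2 * (∑ i, spin (σ i)) ^ 2 + (β - α) / 2 * blockDiff S σ ^ 2) / (2 * N) := by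
  have hM : (∑ i, spin (σ i)) ^ 2 = ∑ i, ∑ j, spin (σ i) * spin (σ j) := by
    rw [sq, Finset.sum_mul_sum]
  have hD : blockDiff S σ ^ 2 =
      ∑ i, ∑ j, blockSign S i * spin (σ i) * (blockSign S j * spin (σ j)) := by
    rw [blockDiff, sq, Finset.sum_mul_sum]
  have h1 : (∑ i : Fin N, ∑ j : Fin N, if SameBlock S i j then spin (σ i) * spin (σ j) else 0) =
      ((∑ i, spin (σ i)) ^ 2 + blockDiff S σ ^ 2) / 2 := by
    rw [hM, hD, ← Finset.sum_add_distrib, Finset.sum_div]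
    refine Finset.sum_congr rfl fun i _ => ?_
    rw [← Finset.sum_add_distrib, Finset.sum_div]
    refine Finset.sum_congr rfl fun j _ => ?_
    by_cases hi : i ∈ S <;> by_cases hj : j ∈ S <;> simp [SameBlock, blockSign, hi, hj]
  have h2 : (∑ i : Fin N, ∑ j : Fin N, if SameBlock S i j then 0 else spin (σ i) * spin (σ j)) =
      ((∑ i, spin (σ i)) ^ 2 - blockDiff S σ ^ 2) / 2 := by
    rw [hM, hD, ← Finset.sum_sub_distrib, Finset.sum_div]
    refine Finset.sum_congr rfl fun i _ => ?_
    rw [← Finset.sum_sub_distrib, Finset.sum_div]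
    refine Finset.sum_congr rfl fun j _ => ?_
    by_cases hi : i ∈ S <;> by_cases hj : j ∈ S <;> simp [SameBlock, blockSign, hi, hj]
  rw [hamiltonian, h1, h2]
  ring

/-- The external field `u + v` on the block `S` and `u - v` on the block `Sᶜ`. -/
noncomputable def latentField {N : ℕ} (S : Finset (Fin N)) (u v : ℝ) (i : Fin N) : ℝ :=
  u + blockSign S i * v

theorem prod_cosh_latentField {N m : ℕ} {S : Finset (Fin N)} (hS : S.card = m) (hN : N = 2 * m)
    (u v : ℝ) : ∏ i, Real.cosh (latentField S u v i) = latentWeight m u v := by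
  have h : ∀ i, Real.cosh (latentField S u v i) =
      if i ∈ S then Real.cosh (u + v) else Real.cosh (u - v) := fun i => by
    unfold latentField blockSign
    split_ifs
    · rw [one_mul]
    · rw [neg_one_mul, ← sub_eq_add_neg]
  simp_rw [h]
  rw [Finset.prod_ite, Finset.prod_const, Finset.prod_const, Finset.filter_mem_eq_inter,
    Finset.univ_inter, Finset.filter_notMem_eq_sdiff, ← Finset.compl_eq_univ_sdiff,
    Finset.card_compl, Fintype.card_fin, hS, show N - m = m by omega, ← mul_pow]
  rfl

theorem exp_sum_latentField {N m : ℕ} {S : Finset (Fin N)} (hS : S.card = m) (hN : N = 2 * m)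
    (u v : ℝ) (σ : Config N) :
    Real.exp (u * (∑ i, spin (σ i)) + v * blockDiff S σ) =
      2 ^ N * (latentWeight m u v * fieldWeight (latentField S u v) σ) := by
  have hc : ∀ i, Real.exp (latentField S u v i * spin (σ i)) =
      2 * (Real.cosh (latentField S u v i) * (Real.exp (latentField S u v i * spin (σ i)) /
        (2 * Real.cosh (latentField S u v i)))) := fun i => by
    have := (Real.cosh_pos (latentField S u v i)).ne'
    field_simp
  calc _ = ∏ i, Real.exp (latentField S u v i * spin (σ i)) := by
        rw [← Real.exp_sum, blockDiff, Finset.mul_sum, Finset.mul_sum, ← Finset.sum_add_distrib]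
        congr 1
        refine Finset.sum_congr rfl fun i _ => ?_
        unfold latentField
        ring
    _ = _ := by
        rw [Finset.prod_congr rfl fun i _ => hc i, Finset.prod_mul_distrib,
          Finset.prod_mul_distrib, prod_cosh_latentField hS hN]
        simp [fieldWeight]

theorem continuous_fieldWeight_latentField {N : ℕ} (S : Finset (Fin N)) (p r : ℝ) (σ : Config N) :
    Continuous fun x : ℝ × ℝ => fieldWeight (latentField S (p * x.1) (r * x.2)) σ := by
  unfold fieldWeight latentField
  refine continuous_finsetProd _ fun i _ => ?_
  refine Continuous.div (by fun_prop) (by fun_prop) fun x => ?_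
  have := Real.cosh_pos (p * x.1 + blockSign S i * (r * x.2))
  positivity

theorem fieldWeight_le_one {ι : Type*} [Fintype ι] [DecidableEq ι] (h : ι → ℝ) (σ : ι → Bool) :
    fieldWeight h σ ≤ 1 := by
  rw [← sum_fieldWeight h]
  exact Finset.single_le_sum (fun σ _ => fieldWeight_nonneg h σ) (Finset.mem_univ σ)

/-- The Hubbard–Stratonovich transformation: two Gaussian integrals linearise the squares of the
magnetisation and of the block difference in the Gibbs factor. -/
theorem exp_neg_hamiltonian {N m : ℕ} (hm : 0 < m) {S : Finset (Fin N)} (hS : S.card = m)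
    (hN : N = 2 * m) {α β : ℝ} (ha : 0 ≤ (β + α) / 2) (hb : 0 ≤ (β - α) / 2) (σ : Config N) :
    Real.exp (-hamiltonian α β S σ) =
      2 ^ N * ∫ x : ℝ × ℝ,
        latentWeight m (√((β + α) / 2 / N) * x.1) (√((β - α) / 2 / N) * x.2) *
          fieldWeight (latentField S (√((β + α) / 2 / N) * x.1) (√((β - α) / 2 / N) * x.2)) σ
        ∂((gaussianReal 0 1).prod (gaussianReal 0 1)) := by
  rw [← integral_const_mul]
  simp_rw [← exp_sum_latentField hS hN]
  set M := ∑ i, spin (σ i)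
  set D := blockDiff S σ with hD
  have hN0 : (0 : ℝ) < N := by rw [hN]; exact_mod_cast (by omega)
  have hx : ∀ x : ℝ × ℝ, Real.exp (√((β + α) / 2 / N) * x.1 * M + √((β - α) / 2 / N) * x.2 * D) =
      Real.exp (√((β + α) / 2 / N) * M * x.1) * Real.exp (√((β - α) / 2 / N) * D * x.2) :=
    fun x => by rw [← Real.exp_add]; congr 1; ring
  simp_rw [hx]
  rw [integral_prod_mul (fun y => Real.exp (√((β + α) / 2 / N) * M * y))
    (fun y => Real.exp (√((β - α) / 2 / N) * D * y)), integral_exp_mul_stdGaussian,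
    integral_exp_mul_stdGaussian, ← Real.exp_add, neg_hamiltonian, mul_pow, mul_pow,
    Real.sq_sqrt (by positivity), Real.sq_sqrt (by positivity), ← hD]
  congr 1
  field_simp
  rfl

/-- The law of the latent fields, as a density with respect to the standard Gaussian measure of the
plane. -/
noncomputable def latentDensity (m : ℕ) (p r : ℝ) (x : ℝ × ℝ) : ℝ :=
  latentWeight m (p * x.1) (r * x.2) /
    ∫ x : ℝ × ℝ, latentWeight m (p * x.1) (r * x.2)
      ∂((gaussianReal 0 1).prod (gaussianReal 0 1))

theorem integral_latentWeight_pos (m : ℕ) (p r : ℝ) :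
    0 < ∫ x : ℝ × ℝ, latentWeight m (p * x.1) (r * x.2)
      ∂((gaussianReal 0 1).prod (gaussianReal 0 1)) := by
  have := integral_mono (integrable_const 1) (integrable_latentWeight m p r) fun x =>
    (one_le_pow₀ (Real.one_le_cosh _)).trans (cosh_pow_le_latentWeight m (p * x.1) (r * x.2))
  simp only [integral_const, probReal_univ, one_smul] at this
  linarith

theorem latentDensity_nonneg (m : ℕ) (p r : ℝ) (x : ℝ × ℝ) : 0 ≤ latentDensity m p r x :=
  div_nonneg (latentWeight_pos _ _ _).le (integral_latentWeight_pos m p r).le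

theorem integrable_latentDensity_mul (m : ℕ) (p r : ℝ) {f : ℝ × ℝ → ℝ} (hf : Continuous f)
    {C : ℝ} (hC : ∀ x, |f x| ≤ C) :
    Integrable (fun x => latentDensity m p r x * f x)
      ((gaussianReal 0 1).prod (gaussianReal 0 1)) :=
  ((integrable_latentWeight m p r).div_const _).mul_bdd (c := C) hf.aestronglyMeasurable
    (ae_of_all _ fun x => by simpa using hC x)

theorem integral_latentDensity (m : ℕ) (p r : ℝ) :
    ∫ x, latentDensity m p r x ∂((gaussianReal 0 1).prod (gaussianReal 0 1)) = 1 := by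
  unfold latentDensity
  rw [integral_div, div_self (integral_latentWeight_pos m p r).ne']

theorem gibbsWeight_eq_integral {N m : ℕ} (hm : 0 < m) {S : Finset (Fin N)} (hS : S.card = m)
    (hN : N = 2 * m) {α β : ℝ} (ha : 0 ≤ (β + α) / 2) (hb : 0 ≤ (β - α) / 2) (σ : Config N) :
    gibbsWeight α β S σ =
      ∫ x : ℝ × ℝ, latentDensity m (√((β + α) / 2 / N)) (√((β - α) / 2 / N)) x *
          fieldWeight (latentField S (√((β + α) / 2 / N) * x.1) (√((β - α) / 2 / N) * x.2)) σ
        ∂((gaussianReal 0 1).prod (gaussianReal 0 1)) := by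
  set p := √((β + α) / 2 / N)
  set r := √((β - α) / 2 / N)
  have hZ : partitionFunction α β S = 2 ^ N * ∫ x : ℝ × ℝ, latentWeight m (p * x.1) (r * x.2)
      ∂((gaussianReal 0 1).prod (gaussianReal 0 1)) := by
    unfold partitionFunction
    simp_rw [exp_neg_hamiltonian hm hS hN ha hb]
    rw [← Finset.mul_sum, ← integral_finsetSum]
    · simp_rw [← Finset.mul_sum, sum_fieldWeight, mul_one]
      rfl
    · intro σ _
      exact integrable_latentWeight_mul m p r (continuous_fieldWeight_latentField S p r σ)
        fun x => by
          rw [abs_of_nonneg (fieldWeight_nonneg _ _)]; exact fieldWeight_le_one _ _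
  rw [gibbsWeight, hZ, exp_neg_hamiltonian hm hS hN ha hb, mul_div_mul_left _ _ (by positivity),
    ← integral_div]
  refine integral_congr_ae (ae_of_all _ fun x => ?_)
  unfold latentDensity
  simp only
  ring

theorem observationLaw_real_eq_sum {N n : ℕ} (α β : ℝ) (S : Finset (Fin N))
    (E : Finset (Fin n → Config N)) :
    (observationLaw α β S n).real E = ∑ σ ∈ E, ∏ k, gibbsWeight α β S (σ k) := by
  unfold observationLaw
  rw [← sum_measureReal_singleton]
  refine Finset.sum_congr rfl fun σ _ => ?_
  rw [measureReal_def, Measure.pi_singleton, ENNReal.toReal_prod]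
  refine Finset.prod_congr rfl fun k _ => ?_
  rw [PMF.toMeasure_apply_singleton _ _ (measurableSet_singleton _), gibbs, PMF.ofFintype_apply,
    ENNReal.toReal_ofReal (gibbsWeight_nonneg _ _ _ _)]

/-- A bound on the probability of an event under independent spins, multiplicative in the latent
fields of the observations, integrates to a bound under the Gibbs measure. -/
theorem observationLaw_real_le {N n m : ℕ} (hm : 0 < m) {S : Finset (Fin N)} (hS : S.card = m)
    (hN : N = 2 * m) {α β : ℝ} (ha : 0 ≤ (β + α) / 2) (hb : 0 ≤ (β - α) / 2)
    (E : Finset (Fin n → Config N)) {C K : ℝ} {f : ℝ × ℝ → ℝ} (hf : Continuous f)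
    (hK : ∀ x, |f x| ≤ K)
    (hE : ∀ x : Fin n → ℝ × ℝ, ∑ σ ∈ E, ∏ k, fieldWeight (latentField S
      (√((β + α) / 2 / N) * (x k).1) (√((β - α) / 2 / N) * (x k).2)) (σ k) ≤ C * ∏ k, f (x k)) :
    (observationLaw α β S n).real E ≤
      C * (∫ x, latentDensity m (√((β + α) / 2 / N)) (√((β - α) / 2 / N)) x * f x
        ∂((gaussianReal 0 1).prod (gaussianReal 0 1))) ^ n := by
  set p := √((β + α) / 2 / N)
  set r := √((β - α) / 2 / N)
  set μ := (gaussianReal 0 1).prod (gaussianReal 0 1) with hμ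
  have hpow : (∫ x, latentDensity m p r x * f x ∂μ) ^ n =
      ∫ x : Fin n → ℝ × ℝ, ∏ k, (latentDensity m p r (x k) * f (x k))
        ∂(Measure.pi fun _ => μ) := by
    rw [integral_fintype_prod_eq_pow (ι := Fin n) (fun x => latentDensity m p r x * f x),
      Fintype.card_fin]
  have hint : ∀ σ : Fin n → Config N, Integrable (fun x : Fin n → ℝ × ℝ =>
      ∏ k, (latentDensity m p r (x k) *
        fieldWeight (latentField S (p * (x k).1) (r * (x k).2)) (σ k)))
      (Measure.pi fun _ => μ) := fun σ =>
    Integrable.fintype_prod (f := fun k x => latentDensity m p r x *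
        fieldWeight (latentField S (p * x.1) (r * x.2)) (σ k)) fun k =>
      integrable_latentDensity_mul m p r (continuous_fieldWeight_latentField S p r (σ k))
        fun x => by rw [abs_of_nonneg (fieldWeight_nonneg _ _)]; exact fieldWeight_le_one _ _
  rw [observationLaw_real_eq_sum, hpow, ← integral_const_mul]
  simp_rw [gibbsWeight_eq_integral hm hS hN ha hb]
  have hprod : ∀ σ : Fin n → Config N, ∏ k, ∫ x : ℝ × ℝ, latentDensity m p r x *
      fieldWeight (latentField S (p * x.1) (r * x.2)) (σ k) ∂μ =
      ∫ x : Fin n → ℝ × ℝ, ∏ k, (latentDensity m p r (x k) *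
        fieldWeight (latentField S (p * (x k).1) (r * (x k).2)) (σ k))
      ∂(Measure.pi fun _ => μ) := fun σ =>
    (integral_fintype_prod_eq_prod (fun k x => latentDensity m p r x *
        fieldWeight (latentField S (p * x.1) (r * x.2)) (σ k))).symm
  rw [Finset.sum_congr rfl fun σ _ => hprod σ, ← integral_finsetSum _ fun σ _ => hint σ]
  refine integral_mono (integrable_finsetSum _ fun σ _ => hint σ)
    ((Integrable.fintype_prod (f := fun _ x => latentDensity m p r x * f x) fun _ =>
      integrable_latentDensity_mul m p r hf hK).const_mul C) fun x => ?_
  simp_rw [Finset.prod_mul_distrib]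
  rw [← Finset.mul_sum, mul_left_comm]
  exact mul_le_mul_of_nonneg_left (hE x)
    (Finset.prod_nonneg fun k _ => latentDensity_nonneg m p r (x k))

/-! ### Exponential inequalities for competing blocks -/

theorem card_symmDiff_eq_card_subtype {N : ℕ} (S T : Finset (Fin N)) :
    Fintype.card {i // ¬(i ∈ S ↔ i ∈ T)} = (symmDiff S T).card := by
  rw [Fintype.card_subtype]
  congr 1
  ext i
  simp only [Finset.mem_filter, Finset.mem_univ, true_and, Finset.mem_symmDiff]
  tauto

/-- One observation with independent spins favours a competing block `T` over `S` with
exponentially small weight in the distance of `T` and `S`. -/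
theorem sum_fieldWeight_mul_exp_blockDiff_le {N : ℕ} {S T : Finset (Fin N)}
    (hS : 2 * S.card = N) (hT : 2 * T.card = N) (hST : 2 * (symmDiff S T).card ≤ N) (u v : ℝ)
    {t : ℝ} (ht : 0 ≤ t) (htN : N * t ≤ 1 / 4) :
    ∑ σ : Config N, fieldWeight (latentField S u v) σ *
        Real.exp (-(t / 4) * (blockDiff S σ ^ 2 - blockDiff T σ ^ 2)) ≤
      Real.exp (-((symmDiff S T).card * (N * t * blockGap u v ^ 2 / 4 - N * t ^ 2))) := by
  set p : Fin N → Prop := fun i => ¬(i ∈ S ↔ i ∈ T) with hp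
  have hcard : Fintype.card {i // p i} = (symmDiff S T).card := card_symmDiff_eq_card_subtype S T
  have hcard2 : Fintype.card {i // p i} + Fintype.card {i // ¬p i} = N := by
    have := Fintype.sum_subtype_add_sum_subtype p fun _ => (1 : ℕ)
    simpa only [Finset.sum_const, Finset.card_univ, smul_eq_mul, mul_one,
      Fintype.card_fin] using this
  have hN : ((symmDiff S T).card : ℝ) + (Fintype.card {i // ¬p i} : ℝ) = N := by
    rw [← hcard]; exact_mod_cast hcard2
  have hTp : ∀ i : {i // p i}, blockSign T i = -blockSign S i := fun i => by
    have := i.2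
    by_cases h1 : (i : Fin N) ∈ S <;> by_cases h2 : (i : Fin N) ∈ T <;>
      simp_all [blockSign]
  have hTn : ∀ i : {i // ¬p i}, blockSign T i = blockSign S i := fun i => by
    have := i.2
    by_cases h1 : (i : Fin N) ∈ S <;> by_cases h2 : (i : Fin N) ∈ T <;>
      simp_all [blockSign]
  have hs1 := sum_blockSign hS
  have hs2 := sum_blockSign hT
  rw [← Fintype.sum_subtype_add_sum_subtype p] at hs1 hs2
  simp_rw [hTp, hTn] at hs2
  rw [Finset.sum_neg_distrib] at hs2
  have hsp : ∑ i : {i // p i}, blockSign S i = 0 := by linarith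
  have hsn : ∑ i : {i // ¬p i}, blockSign S i = 0 := by linarith
  set κ := (Real.tanh (u + v) + Real.tanh (u - v)) / 2 with hκ
  have hmean : ∀ i, blockSign S i * Real.tanh (latentField S u v i) =
      blockGap u v + blockSign S i * κ := fun i => by
    unfold latentField blockGap
    rcases blockSign_eq_one_or S i with h | h <;> rw [h]
    · rw [one_mul v, one_mul, one_mul, hκ]; ring
    · rw [neg_one_mul v, ← sub_eq_add_neg, hκ]; ring
  have key := sum_sum_fieldWeight_mul_exp_mul_le
    (fun i : {i // p i} => latentField S u v i) (fun i : {i // p i} => blockSign S i)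
    (fun i : {i // ¬p i} => latentField S u v i) (fun i : {i // ¬p i} => blockSign S i)
    (fun i => blockSign_eq_one_or S i) (fun i => blockSign_eq_one_or S i)
    (j := (symmDiff S T).card) (L := Fintype.card {i // ¬p i}) (g := blockGap u v) (t := t)
    (by rw [hcard]) rfl
    (by simp_rw [hmean]; rw [Finset.sum_add_distrib, ← Finset.sum_mul, hsp]; simp [hcard])
    (by simp_rw [hmean]; rw [Finset.sum_add_distrib, ← Finset.sum_mul, hsn]; simp) ht
    (by exact_mod_cast (by omega : (symmDiff S T).card ≤ Fintype.card {i // ¬p i}))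
    (by rw [hN]; exact htN)
  rw [hN] at key
  refine le_trans (le_of_eq ?_) key
  rw [← sum_fieldWeight_mul_eq_sum_sum p (latentField S u v) fun σ₁ σ₂ =>
    Real.exp (-t * ((∑ i : {i // p i}, blockSign S i * spin (σ₁ i)) *
      ∑ i : {i // ¬p i}, blockSign S i * spin (σ₂ i)))]
  refine Finset.sum_congr rfl fun σ _ => ?_
  congr 2
  -- With `V` and `U` the sums over the sites where `S` and `T` differ and agree, the block
  -- differences are `U + V` and `U - V`, and their squares differ by `4 U V`.
  have h1 : blockDiff S σ = (∑ i : {i // p i}, blockSign S i * spin (σ i)) +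
      ∑ i : {i // ¬p i}, blockSign S i * spin (σ i) :=
    (Fintype.sum_subtype_add_sum_subtype p fun i => blockSign S i * spin (σ i)).symm
  have h2 : blockDiff T σ = -(∑ i : {i // p i}, blockSign S i * spin (σ i)) +
      ∑ i : {i // ¬p i}, blockSign S i * spin (σ i) := by
    rw [blockDiff, ← Fintype.sum_subtype_add_sum_subtype p fun i => blockSign T i * spin (σ i)]
    simp_rw [hTp, hTn]
    simp
  rw [h1, h2]
  ring

theorem sum_pow_card_symmDiff {N : ℕ} (S : Finset (Fin N)) (X : ℝ) :
    ∑ T ∈ Finset.univ.erase S, X ^ (symmDiff S T).card = (1 + X) ^ N - 1 := by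
  have h1 : ∑ T : Finset (Fin N), X ^ (symmDiff S T).card = (1 + X) ^ N := by
    rw [Fintype.sum_bijective (symmDiff S)
      (Function.Involutive.bijective fun T => symmDiff_symmDiff_cancel_left S T) _
      (fun T => X ^ T.card) fun _ => rfl]
    have := Fintype.sum_pow_mul_eq_add_pow (Fin N) X 1
    simp only [one_pow, mul_one, Fintype.card_fin] at this
    rw [this, add_comm]
  rw [← h1, ← Finset.add_sum_erase _ _ (Finset.mem_univ S)]
  simp

theorem min_one_add_pow_sub_one_le {X : ℝ} (hX : 0 ≤ X) (N : ℕ) :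
    min 1 ((1 + X) ^ N - 1) ≤ 2 * N * X := by
  by_cases h : (N : ℝ) * X ≤ 1
  · have h0 : 0 ≤ (N : ℝ) * X := by positivity
    have h1 : (1 + X) ^ N ≤ Real.exp (N * X) := by
      rw [Real.exp_nat_mul]
      gcongr
      linarith [Real.add_one_le_exp X]
    have h2 := Real.abs_exp_sub_one_sub_id_le (x := N * X) (by rwa [abs_of_nonneg h0])
    have h3 := (abs_le.mp h2).2
    exact (min_le_right _ _).trans (by nlinarith)
  · exact (min_le_left _ _).trans (by linarith)

/-- The samples on which some other partition explains the data at least as well as `S`: its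
squared block differences have at least as large a sum. -/
noncomputable def misrankedSamples {N : ℕ} (S : Finset (Fin N)) (n : ℕ) :
    Finset (Fin n → Config N) := by
  classical exact
  Finset.univ.filter fun σ => ∃ T : Finset (Fin N), 2 * T.card = N ∧ T ≠ S ∧ T ≠ Sᶜ ∧
    ∑ k, blockDiff S (σ k) ^ 2 ≤ ∑ k, blockDiff T (σ k) ^ 2

/-- A competing partition can be represented by the block closer to `S`. -/
theorem exists_near_of_mem_misrankedSamples {N n : ℕ} {S : Finset (Fin N)}
    (hS : 2 * S.card = N) {σ : Fin n → Config N} (hσ : σ ∈ misrankedSamples S n) :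
    ∃ T : Finset (Fin N), T ≠ S ∧ 2 * T.card = N ∧ 2 * (symmDiff S T).card ≤ N ∧
      ∑ k, blockDiff S (σ k) ^ 2 ≤ ∑ k, blockDiff T (σ k) ^ 2 := by
  simp only [misrankedSamples, Finset.mem_filter, Finset.mem_univ, true_and] at hσ
  obtain ⟨T, hT, h1, h2, h3⟩ := hσ
  by_cases h : 2 * (symmDiff S T).card ≤ N
  · exact ⟨T, h1, hT, h, h3⟩
  · refine ⟨Tᶜ, fun h => h2 (by rw [← h, compl_compl]), ?_, ?_, ?_⟩
    · rw [Finset.card_compl, Fintype.card_fin]; omega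
    · have : symmDiff S Tᶜ = (symmDiff S T)ᶜ := by
        ext i
        simp only [Finset.mem_symmDiff, Finset.mem_compl]
        tauto
      rw [this, Finset.card_compl, Fintype.card_fin]
      omega
    · simpa [blockDiff_compl] using h3

/-- Given the latent fields, the Chernoff bounds for the competing partitions are summed by the
binomial theorem. -/
theorem sum_misrankedSamples_fieldWeight_le {N n : ℕ} {S : Finset (Fin N)} (hS : 2 * S.card = N)
    (u v : Fin n → ℝ) {t : ℝ} (ht : 0 ≤ t) (htN : N * t ≤ 1 / 4) :
    ∑ σ ∈ misrankedSamples S n, ∏ k, fieldWeight (latentField S (u k) (v k)) (σ k) ≤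
      2 * N * ∏ k, Real.exp (-(N * t * blockGap (u k) (v k) ^ 2 / 4 - N * t ^ 2)) := by
  classical
  set X := ∏ k, Real.exp (-(N * t * blockGap (u k) (v k) ^ 2 / 4 - N * t ^ 2)) with hXdef
  have hX : 0 ≤ X := Finset.prod_nonneg fun _ _ => (Real.exp_pos _).le
  set W := fun σ : Fin n → Config N => ∏ k, fieldWeight (latentField S (u k) (v k)) (σ k) with hW
  have hW0 : ∀ σ, 0 ≤ W σ := fun σ => Finset.prod_nonneg fun _ _ => fieldWeight_nonneg _ _
  -- The union bound may exceed `1`; its minimum with `1` is at most linear in `X`, which keeps the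
  -- bound a product over the observations even where some latent fields carry no information.
  refine le_trans (le_min ?_ ?_) (min_one_add_pow_sub_one_le hX N)
  · calc ∑ σ ∈ misrankedSamples S n, W σ ≤ ∑ σ, W σ :=
          Finset.sum_le_sum_of_subset_of_nonneg (Finset.subset_univ _) fun σ _ _ => hW0 σ
      _ = 1 := by
          rw [hW, sum_prod_pi fun k σ => fieldWeight (latentField S (u k) (v k)) σ]
          exact Finset.prod_eq_one fun k _ => sum_fieldWeight _
  · set B := (Finset.univ.erase S).filter fun T : Finset (Fin N) =>
      2 * T.card = N ∧ 2 * (symmDiff S T).card ≤ N with hB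
    set F := fun (T : Finset (Fin N)) (σ : Fin n → Config N) =>
      Real.exp (∑ k, -(t / 4) * (blockDiff S (σ k) ^ 2 - blockDiff T (σ k) ^ 2)) with hF
    calc ∑ σ ∈ misrankedSamples S n, W σ ≤ ∑ σ ∈ misrankedSamples S n, ∑ T ∈ B, W σ * F T σ := by
          refine Finset.sum_le_sum fun σ hσ => ?_
          obtain ⟨T, h1, h2, h3, h4⟩ := exists_near_of_mem_misrankedSamples hS hσ
          have hT : T ∈ B := by simp [hB, h1, h2, h3]
          refine le_trans ?_ (Finset.single_le_sum (f := fun T => W σ * F T σ)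
            (fun T _ => mul_nonneg (hW0 σ) (Real.exp_pos _).le) hT)
          refine le_mul_of_one_le_right (hW0 σ) (Real.one_le_exp ?_)
          rw [← Finset.mul_sum, Finset.sum_sub_distrib]
          nlinarith
      _ ≤ ∑ σ, ∑ T ∈ B, W σ * F T σ :=
          Finset.sum_le_sum_of_subset_of_nonneg (Finset.subset_univ _) fun σ _ _ =>
            Finset.sum_nonneg fun T _ => mul_nonneg (hW0 σ) (Real.exp_pos _).le
      _ = ∑ T ∈ B, ∑ σ, W σ * F T σ := Finset.sum_comm
      _ ≤ ∑ T ∈ B, X ^ (symmDiff S T).card := by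
          refine Finset.sum_le_sum fun T hT => ?_
          simp only [hB, Finset.mem_filter] at hT
          have : ∀ σ, W σ * F T σ = ∏ k, (fieldWeight (latentField S (u k) (v k)) (σ k) *
              Real.exp (-(t / 4) * (blockDiff S (σ k) ^ 2 - blockDiff T (σ k) ^ 2))) := fun σ => by
            rw [Finset.prod_mul_distrib, ← Real.exp_sum]
          simp_rw [this]
          rw [sum_prod_pi fun k σ => fieldWeight (latentField S (u k) (v k)) σ *
              Real.exp (-(t / 4) * (blockDiff S σ ^ 2 - blockDiff T σ ^ 2)), hXdef,
            ← Finset.prod_pow]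
          refine Finset.prod_le_prod (fun k _ => Finset.sum_nonneg fun σ _ =>
            mul_nonneg (fieldWeight_nonneg _ _) (Real.exp_pos _).le) fun k _ => ?_
          refine (sum_fieldWeight_mul_exp_blockDiff_le hS hT.2.1 hT.2.2 (u k) (v k) ht
            htN).trans (le_of_eq ?_)
          rw [← Real.exp_nat_mul]
          congr 1
          ring
      _ ≤ ∑ T ∈ Finset.univ.erase S, X ^ (symmDiff S T).card :=
          Finset.sum_le_sum_of_subset_of_nonneg (Finset.filter_subset _ _) fun T _ _ =>
            pow_nonneg hX _
      _ = _ := sum_pow_card_symmDiff S X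

/-- With `ρ` a lower bound on the mean squared gap of the blocks, the exponent has drift of order
`s ρ` per observation and an error of order `s ^ 2 / N`, which a small `s` makes negligible. -/
theorem observationLaw_misrankedSamples_le {N m n : ℕ} (hm : 0 < m) {S : Finset (Fin N)}
    (hS : S.card = m) (hN : N = 2 * m) {α β : ℝ} (ha : 0 ≤ (β + α) / 2) (hb : 0 ≤ (β - α) / 2)
    {ρ s : ℝ} (hs0 : 0 < s) (hs1 : s ≤ 1 / 4) (hρN : 1 / (N : ℝ) ≤ ρ / s / 16)
    (hρ : ρ * ∫ x : ℝ × ℝ,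
        latentWeight m (√((β + α) / 2 / N) * x.1) (√((β - α) / 2 / N) * x.2)
          ∂((gaussianReal 0 1).prod (gaussianReal 0 1)) ≤
      ∫ x : ℝ × ℝ, latentWeight m (√((β + α) / 2 / N) * x.1) (√((β - α) / 2 / N) * x.2) *
          blockGap (√((β + α) / 2 / N) * x.1) (√((β - α) / 2 / N) * x.2) ^ 2
        ∂((gaussianReal 0 1).prod (gaussianReal 0 1))) :
    (observationLaw α β S n).real (misrankedSamples S n) ≤
      2 * N * Real.exp (-(s * ρ / 16 * n)) := by
  set p := √((β + α) / 2 / N)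
  set r := √((β - α) / 2 / N)
  set μ := (gaussianReal 0 1).prod (gaussianReal 0 1) with hμ
  have hN0 : (0 : ℝ) < N := by rw [hN]; exact_mod_cast (by omega)
  have ht : N * (s / N) = s := by field_simp
  set f := fun x : ℝ × ℝ =>
    Real.exp (-(N * (s / N) * blockGap (p * x.1) (r * x.2) ^ 2 / 4 - N * (s / N) ^ 2)) with hf
  have hgc := continuous_blockGap p r
  have hfc : Continuous f := by
    simp only [hf]
    exact Real.continuous_exp.comp
      (((((hgc.pow 2).const_mul _).div_const 4).sub continuous_const).neg)
  have hNt : (N : ℝ) * (s / N) ^ 2 = s ^ 2 / N := by field_simp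
  have hfK : ∀ x, |f x| ≤ Real.exp (s ^ 2 / N) := fun x => by
    simp only [hf]
    rw [abs_of_pos (Real.exp_pos _), Real.exp_le_exp, hNt, ht]
    have : 0 ≤ s * blockGap (p * x.1) (r * x.2) ^ 2 / 4 := by positivity
    linarith
  refine (observationLaw_real_le hm hS hN ha hb (misrankedSamples S n) hfc hfK fun x =>
    sum_misrankedSamples_fieldWeight_le (t := s / N) (by omega) _ _ (by positivity)
      (by rw [ht]; exact hs1)).trans ?_
  rw [mul_comm (s * ρ / 16), ← mul_neg, Real.exp_nat_mul]
  have hgap : ρ ≤ ∫ x, latentDensity m p r x * blockGap (p * x.1) (r * x.2) ^ 2 ∂μ := by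
    have : ∀ x : ℝ × ℝ, latentDensity m p r x * blockGap (p * x.1) (r * x.2) ^ 2 =
        latentWeight m (p * x.1) (r * x.2) * blockGap (p * x.1) (r * x.2) ^ 2 /
          ∫ x : ℝ × ℝ, latentWeight m (p * x.1) (r * x.2) ∂μ := fun x => by
      unfold latentDensity; ring
    simp_rw [this]
    rw [integral_div, le_div_iff₀ (integral_latentWeight_pos m p r)]
    exact hρ
  have hgi : Integrable (fun x => latentDensity m p r x * blockGap (p * x.1) (r * x.2) ^ 2) μ :=
    integrable_latentDensity_mul m p r (hgc.pow 2) (C := 1) fun x => by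
      rw [abs_of_nonneg (sq_nonneg _)]; exact blockGap_sq_le_one _ _
  have hGi : Integrable (latentDensity m p r) μ := (integrable_latentWeight m p r).div_const _
  have hfi := integrable_latentDensity_mul m p r hfc hfK
  -- `exp (-y) ≤ 1 - y / 2` on `[0, 1]` reduces the Laplace transform to the second moment.
  have hexp : ∀ y : ℝ, 0 ≤ y → y ≤ 1 → Real.exp (-y) ≤ 1 - y / 2 := fun y h0 h1 => by
    have := (abs_le.mp (Real.abs_exp_sub_one_sub_id_le (x := -y)
      (by rwa [abs_neg, abs_of_nonneg h0]))).2
    have h2 := Real.add_one_le_exp y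
    rw [Real.exp_neg]
    have h3 : 1 + y + y ^ 2 / 2 ≤ Real.exp y := by
      have := Real.quadratic_le_exp_of_nonneg h0
      linarith
    rw [inv_eq_one_div, div_le_iff₀ (Real.exp_pos y)]
    nlinarith
  have hpt : ∀ x, latentDensity m p r x * f x ≤ Real.exp (s ^ 2 / N) *
      (latentDensity m p r x -
        s / 8 * (latentDensity m p r x * blockGap (p * x.1) (r * x.2) ^ 2)) := fun x => by
    have hG := latentDensity_nonneg m p r x
    have hb1 := blockGap_sq_le_one (p * x.1) (r * x.2)
    have hb0 := sq_nonneg (blockGap (p * x.1) (r * x.2))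
    have h1 := hexp (s * blockGap (p * x.1) (r * x.2) ^ 2 / 4) (by positivity) (by nlinarith)
    have h2 : f x = Real.exp (s ^ 2 / N) *
        Real.exp (-(s * blockGap (p * x.1) (r * x.2) ^ 2 / 4)) := by
      simp only [hf]
      rw [hNt, ht, ← Real.exp_add]
      congr 1
      ring
    calc latentDensity m p r x * f x = Real.exp (s ^ 2 / N) * (latentDensity m p r x *
          Real.exp (-(s * blockGap (p * x.1) (r * x.2) ^ 2 / 4))) := by rw [h2]; ring
      _ ≤ Real.exp (s ^ 2 / N) * (latentDensity m p r x *
          (1 - s * blockGap (p * x.1) (r * x.2) ^ 2 / 4 / 2)) := by gcongr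
      _ = _ := by ring
  have hfin : ∫ x, latentDensity m p r x * f x ∂μ ≤ Real.exp (-(s * ρ / 16)) := by
    calc _ ≤ ∫ x, Real.exp (s ^ 2 / N) * (latentDensity m p r x -
          s / 8 * (latentDensity m p r x * blockGap (p * x.1) (r * x.2) ^ 2)) ∂μ :=
          integral_mono hfi ((hGi.sub (hgi.const_mul _)).const_mul _) hpt
      _ = Real.exp (s ^ 2 / N) *
          (1 - s / 8 * ∫ x, latentDensity m p r x * blockGap (p * x.1) (r * x.2) ^ 2 ∂μ) := by
          rw [integral_const_mul, integral_sub hGi (hgi.const_mul _), integral_const_mul,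
            integral_latentDensity]
      _ ≤ Real.exp (s ^ 2 / N) * Real.exp (-(s / 8 * ρ)) := by
          gcongr
          have h1 := Real.add_one_le_exp (-(s / 8 * ρ))
          have h2 : s / 8 * ρ ≤
              s / 8 * ∫ x, latentDensity m p r x * blockGap (p * x.1) (r * x.2) ^ 2 ∂μ := by
            gcongr
          linarith
      _ ≤ _ := by
          rw [← Real.exp_add, Real.exp_le_exp]
          have : s ^ 2 / N ≤ s * ρ / 16 := by
            calc s ^ 2 / N = s ^ 2 * (1 / N) := by ring
              _ ≤ s ^ 2 * (ρ / s / 16) := by gcongr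
              _ = s * ρ / 16 := by field_simp
          linarith
  have h0 : 0 ≤ ∫ x, latentDensity m p r x * f x ∂μ :=
    integral_nonneg fun x => mul_nonneg (latentDensity_nonneg m p r x) (Real.exp_pos _).le
  gcongr

/-! ### The algorithm -/

/-- The number of positions at which two lists agree, a missing entry of `r` counting as the default
value. -/
def agreements (c r : List Bool) : ℕ :=
  ((List.range c.length).map fun i => if c.getI i = r.getI i then 1 else 0).sum

/-- The number of positions at which two lists disagree, a missing entry of `r` counting as the
default value. -/
def disagreements (c r : List Bool) : ℕ :=
  ((List.range c.length).map fun i => if c.getI i = r.getI i then 0 else 1).sum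

/-- The number of entries `true` of a list. -/
def trueCount (c : List Bool) : ℕ := (c.map fun b => if b = true then 1 else 0).sum

/-- The sum of agreements times disagreements over the observations. Four times each summand is
`N ^ 2 - D ^ 2` for the block difference `D`, so for `α < β` the cost of a balanced partition is an
increasing affine function of the negative log-likelihood; it is a natural number. -/
def partitionCost (data : List (List Bool)) (c : List Bool) : ℕ :=
  (data.map fun r => agreements c r * disagreements c r).sum

/-- The lists of Booleans of the same length as the given list. -/
def sameLengthLists (l : List Bool) : List (List Bool) :=
  l.foldr (fun _ acc => acc.map (List.cons true) ++ acc.map (List.cons false)) [[]]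

/-- The candidates for the block: the lists as long as the first observation in which half of the
entries are `true`. -/
def balancedCandidates (data : List (List Bool)) : List (List Bool) :=
  (sameLengthLists data.headI).filter fun c => 2 * trueCount c = c.length

/-- The maximum likelihood estimator of the block, by exhaustive search. -/
def recoverBlock (data : List (List Bool)) : List Bool :=
  (balancedCandidates data).foldr
    (fun c best => if partitionCost data c ≤ partitionCost data best then c else best)
    (balancedCandidates data).headI

open Primrec in
theorem primrec_list_sum : Primrec (List.sum : List ℕ → ℕ) :=
  (list_foldr Primrec.id (Primrec.const 0)
    (nat_add.comp (fst.comp snd) (snd.comp snd)).to₂).of_eq fun l => by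
      induction l <;> simp_all

open Primrec in
theorem primrec_agreements : Primrec₂ agreements := by
  have hf : Primrec fun x : List Bool × List Bool => List.range x.1.length :=
    list_range.comp (list_length.comp fst)
  have hg : Primrec₂ fun (x : List Bool × List Bool) (i : ℕ) =>
      if x.1.getI i = x.2.getI i then 1 else 0 :=
    Primrec.ite (Primrec.eq.comp (list_getI.comp (fst.comp fst) snd)
      (list_getI.comp (snd.comp fst) snd)) (Primrec.const 1) (Primrec.const 0)
  exact primrec_list_sum.comp (list_map hf hg)

open Primrec in
theorem primrec_disagreements : Primrec₂ disagreements := by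
  have hf : Primrec fun x : List Bool × List Bool => List.range x.1.length :=
    list_range.comp (list_length.comp fst)
  have hg : Primrec₂ fun (x : List Bool × List Bool) (i : ℕ) =>
      if x.1.getI i = x.2.getI i then 0 else 1 :=
    Primrec.ite (Primrec.eq.comp (list_getI.comp (fst.comp fst) snd)
      (list_getI.comp (snd.comp fst) snd)) (Primrec.const 0) (Primrec.const 1)
  exact primrec_list_sum.comp (list_map hf hg)

open Primrec in
theorem primrec_trueCount : Primrec trueCount :=
  primrec_list_sum.comp (list_map Primrec.id
    (Primrec.ite (Primrec.eq.comp snd (Primrec.const true)) (Primrec.const 1)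
      (Primrec.const 0)))

open Primrec in
theorem primrec_partitionCost : Primrec₂ partitionCost :=
  primrec_list_sum.comp (list_map fst
    (nat_mul.comp (primrec_agreements.comp (snd.comp fst) snd)
      (primrec_disagreements.comp (snd.comp fst) snd)))

open Primrec in
theorem primrec_sameLengthLists : Primrec sameLengthLists :=
  list_foldr Primrec.id (Primrec.const [[]])
    (list_append.comp
      (list_map (snd.comp snd) (list_cons.comp (Primrec.const true) snd).to₂)
      (list_map (snd.comp snd) (list_cons.comp (Primrec.const false) snd).to₂)).to₂

open Primrec in
theorem primrec_balancedCandidates : Primrec balancedCandidates :=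
  (listFilter (p := fun c : List Bool => 2 * trueCount c = c.length)
    (Primrec.eq.comp (nat_mul.comp (Primrec.const 2) primrec_trueCount) list_length)).comp
    (primrec_sameLengthLists.comp list_headI)

open Primrec in
theorem primrec_recoverBlock : Primrec recoverBlock :=
  list_foldr primrec_balancedCandidates (list_headI.comp primrec_balancedCandidates)
    (Primrec.ite (nat_le.comp (primrec_partitionCost.comp fst (fst.comp snd))
      (primrec_partitionCost.comp fst (snd.comp snd))) (fst.comp snd) (snd.comp snd)).to₂

/-- The fold that keeps the better of two candidates computes a minimiser; the initial value takes
part only in that it may be returned. -/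
theorem foldr_argmin_mem_and_le {ι : Type*} (f : ι → ℕ) (l : List ι) (a : ι) :
    (l.foldr (fun c best => if f c ≤ f best then c else best) a = a ∨
      l.foldr (fun c best => if f c ≤ f best then c else best) a ∈ l) ∧
    ∀ c ∈ l, f (l.foldr (fun c best => if f c ≤ f best then c else best) a) ≤ f c := by
  induction l with
  | nil => simp
  | cons b l ih =>
    obtain ⟨h1, h2⟩ := ih
    simp only [List.foldr_cons, List.mem_cons, forall_eq_or_imp]
    split_ifs with h
    · exact ⟨Or.inr (Or.inl rfl), le_rfl, fun c hc => h.trans (h2 c hc)⟩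
    · exact ⟨h1.imp_right Or.inr, (not_le.mp h).le, h2⟩

theorem recoverBlock_mem_and_le {data : List (List Bool)} {c : List Bool}
    (hc : c ∈ balancedCandidates data) :
    recoverBlock data ∈ balancedCandidates data ∧
      partitionCost data (recoverBlock data) ≤ partitionCost data c := by
  obtain ⟨h1, h2⟩ := foldr_argmin_mem_and_le (partitionCost data) (balancedCandidates data)
    (balancedCandidates data).headI
  refine ⟨h1.elim (fun h => ?_) id, h2 c hc⟩
  unfold recoverBlock
  rw [h]
  cases hl : balancedCandidates data with
  | nil => simp [hl] at hc
  | cons b l => simp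

theorem mem_sameLengthLists {l c : List Bool} : c ∈ sameLengthLists l ↔ c.length = l.length := by
  induction l generalizing c with
  | nil => simp [sameLengthLists]
  | cons b l ih =>
    have : sameLengthLists (b :: l) = (sameLengthLists l).map (List.cons true) ++
      (sameLengthLists l).map (List.cons false) := rfl
    rw [this]
    cases c with
    | nil => simp
    | cons d c => cases d <;> simp [ih]

theorem sum_map_range (N : ℕ) (f : ℕ → ℕ) : ((List.range N).map f).sum = ∑ i : Fin N, f i := by
  rw [← Fin.sum_univ_eq_sum_range f N |>.symm]
  rfl

theorem getI_ofFn {N : ℕ} (f : Fin N → Bool) (i : Fin N) : (List.ofFn f).getI i = f i := by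
  rw [List.getI_eq_getElem _ (by simp)]
  simp

theorem trueCount_encodeBlock {N : ℕ} (T : Finset (Fin N)) : trueCount (encodeBlock T) = T.card := by
  unfold trueCount encodeBlock
  rw [List.map_ofFn, List.sum_ofFn]
  simp

theorem exists_encodeBlock_eq {N : ℕ} {c : List Bool} (hc : c.length = N) :
    ∃ T : Finset (Fin N), encodeBlock T = c := by
  subst hc
  refine ⟨Finset.univ.filter fun i => c.get i = true, ?_⟩
  unfold encodeBlock
  simp

theorem four_mul_agreements_mul_disagreements {N : ℕ} (T : Finset (Fin N)) (σ : Config N) :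
    4 * ((agreements (encodeBlock T) (List.ofFn σ) *
      disagreements (encodeBlock T) (List.ofFn σ) : ℕ) : ℝ) = (N : ℝ) ^ 2 - blockDiff T σ ^ 2 := by
  have hlen : (encodeBlock T).length = N := by simp [encodeBlock]
  have hA : (agreements (encodeBlock T) (List.ofFn σ) : ℝ) =
      ∑ i, (1 + blockSign T i * spin (σ i)) / 2 := by
    unfold agreements
    rw [hlen, sum_map_range]
    push_cast
    refine Finset.sum_congr rfl fun i _ => ?_
    rw [getI_ofFn, encodeBlock, getI_ofFn]
    by_cases h : i ∈ T <;> cases h2 : σ i <;> simp [h, blockSign, spin]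
  have hB : (disagreements (encodeBlock T) (List.ofFn σ) : ℝ) =
      ∑ i, (1 - blockSign T i * spin (σ i)) / 2 := by
    unfold disagreements
    rw [hlen, sum_map_range]
    push_cast
    refine Finset.sum_congr rfl fun i _ => ?_
    rw [getI_ofFn, encodeBlock, getI_ofFn]
    by_cases h : i ∈ T <;> cases h2 : σ i <;> simp [h, blockSign, spin]
  push_cast
  rw [hA, hB, ← Finset.sum_div, ← Finset.sum_div, Finset.sum_add_distrib, Finset.sum_sub_distrib]
  simp only [Finset.sum_const, Finset.card_univ, Fintype.card_fin, nsmul_eq_mul, mul_one]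
  rw [← blockDiff]
  ring

theorem four_mul_partitionCost {N n : ℕ} (T : Finset (Fin N)) (σ : Fin n → Config N) :
    4 * (partitionCost (encodeObservations σ) (encodeBlock T) : ℝ) =
      n * (N : ℝ) ^ 2 - ∑ k, blockDiff T (σ k) ^ 2 := by
  unfold partitionCost encodeObservations
  rw [List.map_ofFn, List.sum_ofFn, Nat.cast_sum, Finset.mul_sum]
  simp only [Function.comp_apply, four_mul_agreements_mul_disagreements]
  simp

theorem mem_balancedCandidates {N n : ℕ} (hn : 0 < n) (σ : Fin n → Config N) {c : List Bool} :
    c ∈ balancedCandidates (encodeObservations σ) ↔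
      ∃ T : Finset (Fin N), 2 * T.card = N ∧ encodeBlock T = c := by
  have hhead : (encodeObservations σ).headI.length = N := by
    obtain ⟨n, rfl⟩ : ∃ k, n = k + 1 := ⟨n - 1, by omega⟩
    simp [encodeObservations, List.ofFn_succ]
  unfold balancedCandidates
  rw [List.mem_filter, mem_sameLengthLists, hhead, decide_eq_true_eq]
  constructor
  · rintro ⟨h1, h2⟩
    obtain ⟨T, rfl⟩ := exists_encodeBlock_eq h1
    rw [trueCount_encodeBlock, h1] at h2
    exact ⟨T, h2, rfl⟩
  · rintro ⟨T, h, rfl⟩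
    have hlen : (encodeBlock T).length = N := by simp [encodeBlock]
    rw [trueCount_encodeBlock, hlen]
    exact ⟨rfl, h⟩

theorem isBlockStructure_recoverBlock {N n : ℕ} (hn : 0 < n) {S : Finset (Fin N)}
    (hS : 2 * S.card = N) {σ : Fin n → Config N} (hσ : σ ∉ misrankedSamples S n) :
    IsBlockStructure S (recoverBlock (encodeObservations σ)) := by
  obtain ⟨h1, h2⟩ := recoverBlock_mem_and_le
    ((mem_balancedCandidates hn σ).mpr ⟨S, hS, rfl⟩)
  obtain ⟨T, hT, hTe⟩ := (mem_balancedCandidates hn σ).mp h1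
  rw [← hTe] at h2 ⊢
  have h3 : (partitionCost (encodeObservations σ) (encodeBlock T) : ℝ) ≤
    partitionCost (encodeObservations σ) (encodeBlock S) := by exact_mod_cast h2
  have h4 := four_mul_partitionCost T σ
  have h5 := four_mul_partitionCost S σ
  simp only [misrankedSamples, Finset.mem_filter, Finset.mem_univ, true_and, not_exists,
    not_and] at hσ
  by_cases hTS : T = S
  · exact Or.inl (by rw [hTS])
  · by_cases hTc : T = Sᶜ
    · exact Or.inr (by rw [hTc])
    · exact absurd (by linarith) (hσ T hT hTS hTc)

/-! ### Exact recovery -/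

theorem one_sub_le_recoveryProbability {N n : ℕ} (hn : 0 < n) (α β : ℝ) {S : Finset (Fin N)}
    (hS : 2 * S.card = N) :
    1 - (observationLaw α β S n).real (misrankedSamples S n) ≤
      recoveryProbability α β S n recoverBlock := by
  have : IsProbabilityMeasure (observationLaw α β S n) := by
    unfold observationLaw; infer_instance
  rw [← probReal_compl_eq_one_sub (Finset.measurableSet _)]
  exact measureReal_mono fun σ hσ => isBlockStructure_recoverBlock hn hS (by simpa using hσ)

/-- If the squared difference of the block means is at least of order `1 / R N`, then `R N` times a
logarithm is a sufficient number of observations. -/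
theorem exists_constant_recoverBlock {α β : ℝ} (ha : 0 ≤ (β + α) / 2) (hb : 0 ≤ (β - α) / 2)
    (R : ℕ → ℝ) (hR0 : ∀ m : ℕ, 0 < m → 0 < R (2 * m))
    (hRN : ∀ m : ℕ, 0 < m → R (2 * m) ≤ (2 * m : ℕ)) {c : ℝ} (hc : 0 < c)
    (hgap : ∀ m : ℕ, 0 < m → c * (1 / R (2 * m)) * ∫ x : ℝ × ℝ,
        latentWeight m (√((β + α) / 2 / (2 * m : ℕ)) * x.1) (√((β - α) / 2 / (2 * m : ℕ)) * x.2)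
          ∂((gaussianReal 0 1).prod (gaussianReal 0 1)) ≤
      ∫ x : ℝ × ℝ,
        latentWeight m (√((β + α) / 2 / (2 * m : ℕ)) * x.1) (√((β - α) / 2 / (2 * m : ℕ)) * x.2) *
          blockGap (√((β + α) / 2 / (2 * m : ℕ)) * x.1) (√((β - α) / 2 / (2 * m : ℕ)) * x.2) ^ 2
        ∂((gaussianReal 0 1).prod (gaussianReal 0 1))) :
    ∃ C : ℝ, 0 < C ∧ ∀ N : ℕ, 0 < N → ∀ S : Finset (Fin N), 2 * S.card = N →
      ∀ δ : ℝ, 0 < δ → δ < 1 → ∀ n : ℕ, C * R N * Real.log ((N : ℝ) / δ) ≤ (n : ℝ) →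
        1 - δ ≤ recoveryProbability α β S n recoverBlock := by
  set s := min (1 / 4) (c / 16) with hs
  have hs0 : 0 < s := by positivity
  refine ⟨32 / (s * c), by positivity, fun N hN S hS δ hδ0 hδ1 n hn => ?_⟩
  obtain ⟨m, hm⟩ : ∃ m, S.card = m := ⟨_, rfl⟩
  have hNm : N = 2 * m := by omega
  have hm0 : 0 < m := by omega
  have hR := hR0 m hm0
  have hRN' := hRN m hm0
  have hg := hgap m hm0
  rw [← hNm] at hR hRN' hg
  have hN2 : (2 : ℝ) ≤ N := by exact_mod_cast (by omega : 2 ≤ N)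
  have hN0 : (0 : ℝ) < N := by linarith
  have hlog : 0 < Real.log ((N : ℝ) / δ) := by
    refine Real.log_pos ?_
    rw [lt_div_iff₀ hδ0]
    linarith
  -- The algorithm reads off `N` from the first observation, so there has to be one.
  have hn0 : 0 < n := by
    have : (0 : ℝ) < n := lt_of_lt_of_le (by positivity) hn
    exact_mod_cast this
  have hbound := observationLaw_misrankedSamples_le (n := n) hm0 hm hNm ha hb (ρ := c * (1 / R N))
    hs0 (min_le_left _ _) (by
      have h1 : s * 16 ≤ c := by linarith [min_le_right (1 / 4) (c / 16)]
      rw [div_div, div_le_div_iff₀ hN0 (by positivity), one_mul]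
      have h2 : (1 : ℝ) ≤ N / R N := (one_le_div hR).mpr hRN'
      calc s * 16 ≤ c * 1 := by linarith
        _ ≤ c * (N / R N) := by gcongr
        _ = c * (1 / R N) * N := by ring) hg
  -- The constant makes the exponent twice the logarithm: one factor `δ / N` absorbs the prefactor
  -- `2 N` up to the other factor.
  have hexp : Real.exp (-(s * (c * (1 / R N)) / 16 * n)) ≤ (δ / N) ^ 2 := by
    have h1 : 2 * Real.log ((N : ℝ) / δ) ≤ s * (c * (1 / R N)) / 16 * n := by
      calc 2 * Real.log ((N : ℝ) / δ)
          = s * (c * (1 / R N)) / 16 * (32 / (s * c) * R N * Real.log ((N : ℝ) / δ)) := by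
            field_simp
            ring
        _ ≤ _ := by gcongr
    calc _ ≤ Real.exp (-(2 * Real.log ((N : ℝ) / δ))) := by gcongr
      _ = (δ / N) ^ 2 := by
        rw [← mul_neg, ← Real.log_inv, inv_div, show (2 : ℝ) = ((2 : ℕ) : ℝ) by norm_num,
          Real.exp_nat_mul, Real.exp_log (by positivity)]
  have hfin : 2 * (N : ℝ) * (δ / N) ^ 2 ≤ δ := by
    rw [div_pow, mul_div_assoc', div_le_iff₀ (by positivity)]
    have : δ ^ 2 ≤ δ := by nlinarith
    nlinarith [mul_pos hδ0 hN0, mul_le_mul_of_nonneg_left this hN0.le]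
  have := one_sub_le_recoveryProbability hn0 α β hS
  have h2 : 2 * (N : ℝ) * Real.exp (-(s * (c * (1 / R N)) / 16 * n)) ≤ 2 * N * (δ / N) ^ 2 := by
    gcongr
  linarith

end BlockIsing

/-- On the critical line, blocks of the block spin Ising model are recovered exactly from
`C₃ N log (N / δ)` observations if `α > 0`, and from `C₄ √N log (N / δ)` ones if `α < 0`. The
constant and the algorithm `A` (a computable function of the observations) depend on neither of
`N`, `S`, `δ`, `n`. -/
theorem theorem1p3 (α β : ℝ) (habs : |α| ≤ β) (hlt : α < β) (hne : α ≠ 0)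
    (hcrit : |α| + β = 2) :
    (0 < α →
      ∃ C₃ : ℝ, 0 < C₃ ∧ ∃ A : List (List Bool) → List Bool, Computable A ∧
        ∀ (N : ℕ), 0 < N → ∀ S : Finset (Fin N), 2 * S.card = N →
          ∀ δ : ℝ, 0 < δ → δ < 1 → ∀ n : ℕ,
            C₃ * (N : ℝ) * Real.log ((N : ℝ) / δ) ≤ (n : ℝ) →
              1 - δ ≤ BlockIsing.recoveryProbability α β S n A) ∧
    (α < 0 →
      ∃ C₄ : ℝ, 0 < C₄ ∧ ∃ A : List (List Bool) → List Bool, Computable A ∧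
        ∀ (N : ℕ), 0 < N → ∀ S : Finset (Fin N), 2 * S.card = N →
          ∀ δ : ℝ, 0 < δ → δ < 1 → ∀ n : ℕ,
            C₄ * Real.sqrt (N : ℝ) * Real.log ((N : ℝ) / δ) ≤ (n : ℝ) →
              1 - δ ≤ BlockIsing.recoveryProbability α β S n A) := by
  constructor
  · intro hα
    rw [abs_of_pos hα] at habs hcrit
    obtain ⟨c, hc, h⟩ := BlockIsing.exists_blockGap_lower_bound_of_magnetisation_critical
      (b := (β - α) / 2) (by linarith) (by linarith)
    have h1 : (β + α) / 2 = 1 := by linarith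
    obtain ⟨C, hC, hrec⟩ := BlockIsing.exists_constant_recoverBlock (α := α) (β := β)
      (by linarith) (by linarith) (fun N => (N : ℝ))
      (fun m hm => by exact_mod_cast (by omega : 0 < 2 * m)) (fun m _ => le_rfl) hc
      (by rw [h1]; exact h)
    exact ⟨C, hC, BlockIsing.recoverBlock, BlockIsing.primrec_recoverBlock.to_comp, hrec⟩
  · intro hα
    rw [abs_of_neg hα] at habs hcrit
    obtain ⟨c, hc, h⟩ := BlockIsing.exists_blockGap_lower_bound_of_difference_critical
      (a := (β + α) / 2) (by linarith) (by linarith)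
    have h1 : (β - α) / 2 = 1 := by linarith
    obtain ⟨C, hC, hrec⟩ := BlockIsing.exists_constant_recoverBlock (α := α) (β := β)
      (by linarith) (by linarith) (fun N => √(N : ℝ))
      (fun m hm => Real.sqrt_pos.mpr (by exact_mod_cast (by omega : 0 < 2 * m)))
      (fun m hm => by
        have : (1 : ℝ) ≤ (2 * m : ℕ) := by exact_mod_cast (by omega : 1 ≤ 2 * m)
        rw [Real.sqrt_le_left (by positivity)]
        nlinarith) hc
      (by rw [h1]; exact h)
    exact ⟨C, hC, BlockIsing.recoverBlock, BlockIsing.primrec_recoverBlock.to_comp, hrec⟩
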